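/- Let $\mathcal B\subseteq\mathbb N=\{1,2,\dots\}$ be primitive, i.e. no element of $\mathcal B$ divides a different element of $\mathcal B$. Put $\mathcal M_{\mathcal B}=\bigcup_{b\in\mathcal B}b\mathbb Z$ and $\mathcal F_{\mathcal B}=\mathbb Z\setminus\mathcal M_{\mathcal B}$, and let $\boldsymbol\delta(\mathcal M_{\mathcal B})=\lim_{n\to\infty}\frac1{\log n}\sum_{k=1}^n k^{-1}\mathbf 1_{\mathcal M_{\mathcal B}}(k)$ be the logarithmic density (the limit exists by the theorem of Davenport and Erdős). The set $\mathcal B$ is called taut if $\boldsymbol\delta(\mathcal M_{\mathcal B\setminus\{b\}})<\boldsymbol\delta(\mathcal M_{\mathcal B})$ for every $b\in\mathcal B$. Let $\eta\in\{0,1\}^{\mathbb Z}$ be the indicator function of $\mathcal F_{\mathcal B}$ and let $X_\eta\subseteq\{0,1\}^{\mathbb Z}$ be the closure (in the product topology) of its orbit $\{\sigma^n\eta:n\in\mathbb Z\}$ under the left shift $\sigma$. Let $\Delta:\mathbb Z\to\prod_{b\in\mathcal B}\mathbb Z/b\mathbb Z$, $\Delta(n)=(n,n,\dots)$, let $H=\overline{\Delta(\mathbb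 Z)}$, a compact abelian group with normalised Haar measure $m_H$, let $W=\{h\in H: h_b\neq0\ \text{for all } b\in\mathcal B\}$, and define $\varphi:H\to\{0,1\}^{\mathbb Z}$ by $\varphi(h)(n)=1$ if and only if $h+\Delta(n)\in W$. Put $X_\varphi=\overline{\varphi(H)}$, and let $\nu_\eta=m_H\circ\varphi^{-1}$ be the Mirsky measure of $\mathcal B$. If $\mathcal B$ is taut, then $\eta$ is quasi-generic for $\nu_\eta$ (there are $N_1<N_2<\cdots$ such that every finite block occurs in $\eta$ with frequency along $\{1,\dots,N_j\}$ tending, as $j\to\infty$, to the $\nu_\eta$-measure of the corresponding cylinder set), and $$\operatorname{supp}(\nu_\eta)=X_\eta=X_\varphi .$$ -/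

import Mathlib

open Filter Topology MeasureTheory

noncomputable section

namespace BFree

/-- `B` is primitive: no element of `B` divides another (different) element of `B`. -/
def IsPrimitive (B : Set ℕ+) : Prop :=
  ∀ b ∈ B, ∀ b' ∈ B, b ∣ b' → b = b'

/-- The set of multiples `⋃ b ∈ B, b ℤ`. -/
def multiples (B : Set ℕ+) : Set ℤ :=
  {n | ∃ b ∈ B, ((b : ℕ) : ℤ) ∣ n}

/-- The set of `B`-free integers. -/
def free (B : Set ℕ+) : Set ℤ := (multiples B)ᶜ

open Classical in
/-- The averages `(1 / log n) * ∑_{k=1}^n k⁻¹ 1_A(k)`. -/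
def logAverage (A : Set ℤ) (n : ℕ) : ℝ :=
  (∑ k ∈ Finset.Icc 1 n, if (k : ℤ) ∈ A then (k : ℝ)⁻¹ else 0) / Real.log n

/-- The logarithmic density of `A`. It is only used for sets of multiples, for which
the limit exists by the theorem of Davenport and Erdős. -/
def logDensity (A : Set ℤ) : ℝ := limUnder atTop (logAverage A)

/-- `B` is taut: removing any element strictly decreases the logarithmic density of the
set of multiples. -/
def IsTaut (B : Set ℕ+) : Prop :=
  ∀ b ∈ B, logDensity (multiples (B \ {b})) < logDensity (multiples B)

open Classical in
/-- The indicator sequence of the `B`-free integers, a point of `{0,1}^ℤ`. -/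
def eta (B : Set ℕ+) : ℤ → Bool := fun n => decide (n ∈ free B)

/-- The `n`-th power of the left shift on `{0,1}^ℤ`. -/
def shift (n : ℤ) (x : ℤ → Bool) : ℤ → Bool := fun k => x (k + n)

/-- The orbit closure of `eta B` under the shift (product topology on `{0,1}^ℤ`). -/
def Xeta (B : Set ℕ+) : Set (ℤ → Bool) :=
  closure (Set.range fun n : ℤ => shift n (eta B))

/-- The product group `∏_{b ∈ B} ℤ/bℤ`. -/
abbrev ProdZMod (B : Set ℕ+) : Type := (b : B) → ZMod ((b : ℕ+) : ℕ)

/-- The diagonal homomorphism `ℤ → ∏_{b ∈ B} ℤ/bℤ`. -/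
def diag (B : Set ℕ+) : ℤ →+ ProdZMod B where
  toFun n := fun _ => (n : ZMod _)
  map_zero' := by funext b; simp
  map_add' m n := by funext b; simp

/-- The compact group `H`, the closure of the diagonal copy of `ℤ`. -/
abbrev H (B : Set ℕ+) : AddSubgroup (ProdZMod B) := (diag B).range.topologicalClosure

/-- The diagonal homomorphism with values in `H`. -/
def Delta (B : Set ℕ+) : ℤ →+ H B :=
  (diag B).codRestrict (H B) fun n =>
    AddSubgroup.le_topologicalClosure _ (AddMonoidHom.mem_range.2 ⟨n, rfl⟩)

instance instCompactSpaceH (B : Set ℕ+) : CompactSpace (H B) :=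
  isCompact_iff_compactSpace.1 (AddSubgroup.isClosed_topologicalClosure _).isCompact

/-- The window `W = {h ∈ H : h_b ≠ 0 for all b ∈ B}`. -/
def window (B : Set ℕ+) : Set (H B) := {h | ∀ b : B, (h : ProdZMod B) b ≠ 0}

open Classical in
/-- The coding function `φ_A : H → {0,1}^ℤ`, where `φ_A(h)(n) = 1` iff `h + Δ(n) ∈ A`. -/
def coding {B : Set ℕ+} (A : Set (H B)) (h : H B) : ℤ → Bool :=
  fun n => decide (h + Delta B n ∈ A)

/-- The coding function `φ = φ_W`. -/
def phi (B : Set ℕ+) : H B → ℤ → Bool := coding (window B)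

/-- `X_φ`, the closure of `φ(H)`. -/
def Xphi (B : Set ℕ+) : Set (ℤ → Bool) := closure (Set.range (phi B))

/-- The normalised Haar measure on `H`. -/
def haarH (B : Set ℕ+) : Measure (H B) := Measure.addHaarMeasure ⊤

/-- The Mirsky measure `ν_η` on `{0,1}^ℤ`: the image of the Haar measure under `φ`. -/
def mirsky (B : Set ℕ+) : Measure (ℤ → Bool) := (haarH B).map (phi B)

/-- The cylinder set of all `x` which agree with `w` on the finite set `S` of coordinates. -/
def cylinder (S : Finset ℤ) (w : ℤ → Bool) : Set (ℤ → Bool) := {x | ∀ i ∈ S, x i = w i}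

open Classical in
/-- `x` is quasi-generic for `ν`: along a subsequence of times, every finite block occurs in
`x` with the frequency prescribed by `ν`. -/
def IsQuasiGeneric (x : ℤ → Bool) (ν : Measure (ℤ → Bool)) : Prop :=
  ∃ N : ℕ → ℕ, StrictMono N ∧ ∀ (S : Finset ℤ) (w : ℤ → Bool),
    Tendsto (fun j => (((Finset.Icc 1 (N j)).filter fun k : ℕ =>
        shift (k : ℤ) x ∈ cylinder S w).card : ℝ) / (N j : ℝ)) atTop
      (𝓝 (ν.real (cylinder S w)))

end BFree

end

/-!
# Tautness and the support of the Mirsky measure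

All densities are measures of events for a uniformly random profinite integer `x`, i.e. a point of
the compact group `Zhat = H Set.univ` with its Haar measure `haarZ`. A probability measure on `H B`
invariant under adding `Δ(1)` is unique (`eq_of_map_add_Delta_one`); hence `haarH B` is the image
of `haarZ`, and, conditionally on `x ≡ r` modulo `N`, the random integer `x` is distributed like
`r + N x` (`haarZ_inter_residue`). The latter is the only tool needed to compute with `haarZ`: it
gives independence of coprime divisibility conditions and the behaviour under rescaling.

*Davenport–Erdős.* The event that the part of `x` composed of primes up to `y` equals `n` has
probability `κ / n`, where `κ` is the probability that no prime up to `y` divides `x`. Summing over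
the `n ≤ y` in `multiples B` but not in `multiples (trunc B K)` bounds the sum of their reciprocals
by `κ⁻¹` times the probability that `x` is a multiple of some element of `B`, but of none up to
`K`. Since `κ⁻¹` is `O(log y)` (`exists_mertens_bound`), the logarithmic density of `multiples B`
is `haarZ (mult B)` (`tendsto_logAverage_multiples`). The lower density is at most this value, so
there are times along which `multiples B` has asymptotically the frequency `haarZ (mult B)`. Along
these times `eta B` is approximated by the periodic sequences belonging to the sets `trunc B K`,
which gives quasi-genericity (`isQuasiGeneric_eta`) and `supp ν ⊆ X_η`. The inclusion `X_η ⊆ X_φ`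
holds since `η = φ(0)`.

*Tautness.* It remains to see that a pattern on a finite set `S` occurring in a point `φ(h)` has
positive probability (`haarZ_pattern_phi_pos`). The zeros of the pattern are forced by finitely many
congruences. For the ones, choose a highly divisible modulus `L` and an integer `r` that looks like
`h` at the coordinates dividing `L`; then no element of `B` divides `D n = gcd (r + n, L)`. One can
choose `m ≡ r` modulo `L` such that no `(m + n) / D n` has a prime factor up to `K`. If now an
element `b` of `B` divides `m + n + L K! x`, then the quotient of `b` by `c = gcd (b, D n)` divides
`(m + n + L K! x) / D n` and has only prime factors exceeding `K`. Tautness says that the quotients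
`b / c`, for fixed `c ∉ B`, do not have multiples of full measure (`haarZ_mult_quotient_lt_one`),
and by a zero-one law the multiples of those quotients without prime factors up to `K` have measure
tending to `0` as `K` grows (`tendsto_haarZ_mult_rough`). A union bound over the finitely many `n`
and `c` concludes.
-/

open Filter Topology MeasureTheory

noncomputable section

namespace BFree

/-! ### Invariant measures on `H` -/

instance isProbabilityMeasure_haarH (B : Set ℕ+) : IsProbabilityMeasure (haarH B) :=
  ⟨by simpa [haarH] using Measure.addHaarMeasure_self (G := H B) (K₀ := ⊤)⟩

instance isAddLeftInvariant_haarH (B : Set ℕ+) : (haarH B).IsAddLeftInvariant := by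
  unfold haarH; infer_instance

@[simp] lemma coe_Delta (B : Set ℕ+) (n : ℤ) (b : B) :
    (Delta B n : ProdZMod B) b = (n : ZMod ((b : ℕ+) : ℕ)) := rfl

/-- On finitely many coordinates every point of `H` looks like an integer. -/
lemma exists_int_eq {B : Set ℕ+} (h : H B) (s : Set B) (hs : s.Finite) :
    ∃ m : ℤ, ∀ b ∈ s, (h : ProdZMod B) b = m := by
  have hmem : (h : ProdZMod B) ∈ closure ((diag B).range : Set (ProdZMod B)) := h.2
  have hopen : IsOpen (s.pi fun b => ({(h : ProdZMod B) b} : Set (ZMod ((b : ℕ+) : ℕ)))) :=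
    isOpen_set_pi hs fun b _ => isOpen_discrete _
  obtain ⟨g, hg, ⟨m, rfl⟩⟩ := mem_closure_iff.1 hmem _ hopen fun b _ => rfl
  exact ⟨m, fun b hb => (hg b hb).symm⟩

lemma denseRange_Delta (B : Set ℕ+) : DenseRange (Delta B) := by
  intro h
  rw [closure_subtype]
  have hr : ((↑) '' Set.range (Delta B) : Set (ProdZMod B)) = (diag B).range := by
    ext x
    constructor
    · rintro ⟨_, ⟨n, rfl⟩, rfl⟩; exact ⟨n, rfl⟩
    · rintro ⟨n, rfl⟩; exact ⟨_, ⟨n, rfl⟩, rfl⟩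
  rw [hr]
  exact h.2

lemma continuous_coord (B : Set ℕ+) (b : B) : Continuous fun h : H B => (h : ProdZMod B) b :=
  (continuous_apply b).comp continuous_subtype_val

open Classical in
/-- The number of visits to a clopen set during a period does not depend on the starting point:
it is a continuous function, constant on the dense subgroup of integers. -/
lemma card_filter_add_Delta {B : Set ℕ+} {V : Set (H B)} (hV : IsClopen V) {N : ℕ}
    (hN : ∀ h, h + Delta B N ∈ V ↔ h ∈ V) (h : H B) :
    ((Finset.range N).filter fun k : ℕ => h + Delta B k ∈ V).card
      = ((Finset.range N).filter fun k : ℕ => Delta B k ∈ V).card := by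
  set F : H B → ℕ := fun h => ((Finset.range N).filter fun k : ℕ => h + Delta B k ∈ V).card with hF
  have hFsum : ∀ h, F h = ∑ k ∈ Finset.range N, V.indicator (fun _ => 1) (h + Delta B k) := by
    intro h
    simp [hF, Set.indicator_apply]
  have hcont : Continuous F := by
    have : F = fun h => ∑ k ∈ Finset.range N, V.indicator (fun _ => 1) (h + Delta B k) :=
      funext hFsum
    rw [this]
    refine continuous_finsetSum _ fun k _ => ?_
    exact (continuous_const.indicator fun x hx => by simp [hV.frontier_eq] at hx).comp
      (continuous_id.add continuous_const)
  have hstep : ∀ h, F (h + Delta B 1) = F h := by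
    intro h
    rw [hFsum, hFsum]
    have h1 := Finset.sum_range_succ (fun k : ℕ => V.indicator (fun _ => 1) (h + Delta B k)) N
    have h2 := Finset.sum_range_succ' (fun k : ℕ => V.indicator (fun _ => 1) (h + Delta B k)) N
    have h3 : V.indicator (fun _ => 1) (h + Delta B N) = V.indicator (fun _ => 1) h := by
      simp [Set.indicator_apply, hN]
    have h4 : ∀ k : ℕ, h + Delta B 1 + Delta B k = h + Delta B ((k + 1 : ℕ) : ℤ) := by
      intro k; push_cast; rw [map_add]; abel
    simp only [h4]
    simp only [Nat.cast_zero, map_zero, add_zero] at h2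
    rw [h3] at h1
    omega
  have hint : ∀ j : ℤ, F (Delta B j) = F 0 := by
    intro j
    induction j using Int.induction_on with
    | zero => simp
    | succ i ih => rw [map_add, hstep, ih]
    | pred i ih => rw [← hstep, ← map_add, sub_add_cancel, ih]
  have hall : ∀ h, F h = F 0 := by
    have hc : IsClosed {h | F h = F 0} := isClosed_eq hcont continuous_const
    intro h
    have : closure (Set.range (Delta B)) ⊆ {h | F h = F 0} :=
      hc.closure_subset_iff.2 (by rintro _ ⟨j, rfl⟩; exact hint j)
    exact this (denseRange_Delta B h)
  have := hall h
  simpa [hF] using this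

lemma measure_preimage_add_Delta {B : Set ℕ+} {ν : Measure (H B)}
    (hν : ν.map (· + Delta B 1) = ν) {V : Set (H B)} (hV : MeasurableSet V) (k : ℕ) :
    ν {h | h + Delta B k ∈ V} = ν V := by
  have hm : ∀ c : H B, Measurable (fun h : H B => h + c) := fun c =>
    (continuous_id.add continuous_const).measurable
  induction k with
  | zero => simp
  | succ k ih =>
    rw [← ih]
    conv_rhs => rw [← hν]
    change _ = ν.map (· + Delta B 1) ((· + Delta B k) ⁻¹' V)
    rw [Measure.map_apply (hm _) (hm _ hV)]
    congr 1
    ext h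
    simp only [Set.mem_ofPred_eq, Set.mem_preimage]
    push_cast
    rw [map_add, add_comm (Delta B k), add_assoc]

open Classical in
/-- The measure of a clopen set of period `N` is the frequency of its integer points. -/
lemma measure_of_periodic {B : Set ℕ+} {ν : Measure (H B)} [IsProbabilityMeasure ν]
    (hν : ν.map (· + Delta B 1) = ν) {V : Set (H B)} (hV : IsClopen V) {N : ℕ} (hN0 : N ≠ 0)
    (hN : ∀ h, h + Delta B N ∈ V ↔ h ∈ V) :
    ν V = (((Finset.range N).filter fun k : ℕ => Delta B k ∈ V).card : ENNReal) / N := by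
  have hm : ∀ c : H B, Measurable (fun h : H B => h + c) := fun c =>
    (continuous_id.add continuous_const).measurable
  have hVm := hV.isOpen.measurableSet
  have key : ∫⁻ h, ∑ k ∈ Finset.range N, V.indicator (fun _ => (1 : ENNReal)) (h + Delta B k) ∂ν
      = N * ν V := by
    rw [lintegral_finsetSum]
    · have : ∀ k ∈ Finset.range N,
          ∫⁻ h, V.indicator (fun _ => (1 : ENNReal)) (h + Delta B k) ∂ν = ν V := by
        intro k _
        rw [← measure_preimage_add_Delta hν hVm k]
        exact lintegral_indicator_one (hm (Delta B k) hVm)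
      rw [Finset.sum_congr rfl this]
      simp
    · intro k _
      exact (measurable_const.indicator hVm).comp (hm _)
  have key2 : ∫⁻ h, ∑ k ∈ Finset.range N, V.indicator (fun _ => (1 : ENNReal)) (h + Delta B k) ∂ν
      = (((Finset.range N).filter fun k : ℕ => Delta B k ∈ V).card : ENNReal) := by
    have : ∀ h, ∑ k ∈ Finset.range N, V.indicator (fun _ => (1 : ENNReal)) (h + Delta B k)
        = (((Finset.range N).filter fun k : ℕ => Delta B k ∈ V).card : ENNReal) := by
      intro h
      rw [← card_filter_add_Delta hV hN h]
      simp [Set.indicator_apply]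
    simp [this]
  rw [ENNReal.eq_div_iff (by simpa using hN0) (by simp), ← key, key2]

/-- There is only one probability measure on `H` which is invariant under adding `Δ(1)`. -/
lemma eq_of_map_add_Delta_one {B : Set ℕ+} {ν μ : Measure (H B)} [IsProbabilityMeasure ν]
    [IsProbabilityMeasure μ] (hν : ν.map (· + Delta B 1) = ν) (hμ : μ.map (· + Delta B 1) = μ) :
    ν = μ := by
  set C : Set (Set (H B)) :=
    {V | IsClopen V ∧ ∃ N : ℕ, N ≠ 0 ∧ ∀ h, h + Delta B N ∈ V ↔ h ∈ V} with hC
  have hmul : ∀ {V : Set (H B)} {N : ℕ} (_ : ∀ h, h + Delta B N ∈ V ↔ h ∈ V) (M : ℕ) (h : H B),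
      h + Delta B ((N * M : ℕ) : ℤ) ∈ V ↔ h ∈ V := by
    intro V N hN M h
    induction M with
    | zero => simp
    | succ M ih =>
      rw [← ih, ← hN (h + Delta B ((N * M : ℕ) : ℤ)), add_assoc, ← map_add, ← Nat.cast_add,
        ← Nat.mul_succ]
  refine ext_of_generate_finite C ?_ ?_ ?_ (by simp)
  · apply le_antisymm
    · have : @Measurable (H B) (ProdZMod B) (MeasurableSpace.generateFrom C) _ Subtype.val := by
        rw [@measurable_pi_iff]
        intro b t _
        refine MeasurableSpace.measurableSet_generateFrom ⟨?_, (b : ℕ+), (b : ℕ+).ne_zero, ?_⟩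
        · exact (isClopen_discrete t).preimage (continuous_coord B b)
        · intro h
          simp [AddSubgroup.coe_add]
      exact this.comap_le
    · exact MeasurableSpace.generateFrom_le fun V hV => hV.1.isOpen.measurableSet
  · rintro V ⟨hV, N, hN0, hN⟩ V' ⟨hV', N', hN0', hN'⟩ -
    refine ⟨hV.inter hV', N * N', mul_ne_zero hN0 hN0', fun h => ?_⟩
    have h1 := hmul hN N' h
    have h2 := hmul hN' N h
    rw [mul_comm N'] at h2
    exact and_congr h1 h2
  · rintro V ⟨hV, N, hN0, hN⟩
    classical
    rw [measure_of_periodic hν hV hN0 hN, measure_of_periodic hμ hV hN0 hN]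

lemma haarH_map_add_Delta_one (B : Set ℕ+) : (haarH B).map (· + Delta B 1) = haarH B := by
  simp only [add_comm _ (Delta B 1)]
  exact map_add_left_eq_self _ _

/-! ### Random profinite integers -/

/-- The profinite integers, realised as the group `H` of the set of all positive integers. -/
abbrev Zhat : Type := H (Set.univ : Set ℕ+)

/-- The Haar probability measure on the profinite integers. -/
abbrev haarZ : Measure Zhat := haarH Set.univ

/-- The embedding of the integers into the profinite integers. -/
abbrev toZhat : ℤ →+ Zhat := Delta Set.univ

/-- Reduction of a profinite integer modulo `n`. -/
def red (n : ℕ+) : Zhat →+ ZMod (n : ℕ) where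
  toFun x := (x : ProdZMod Set.univ) ⟨n, trivial⟩
  map_zero' := rfl
  map_add' _ _ := rfl

@[simp] lemma red_toZhat (n : ℕ+) (k : ℤ) : red n (toZhat k) = k := rfl

lemma continuous_red (n : ℕ+) : Continuous (red n) := continuous_coord Set.univ ⟨n, trivial⟩

lemma measurable_red (n : ℕ+) : Measurable (red n) := (continuous_red n).measurable

lemma exists_int_red (x : Zhat) (s : Finset ℕ+) : ∃ m : ℤ, ∀ n ∈ s, red n x = m := by
  obtain ⟨m, hm⟩ := exists_int_eq x (Subtype.val ⁻¹' (s : Set ℕ+))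
    (s.finite_toSet.preimage Subtype.val_injective.injOn)
  exact ⟨m, fun n hn => hm ⟨n, trivial⟩ hn⟩

lemma red_eq_of_dvd {d n : ℕ+} (h : d ∣ n) {x : Zhat} {r : ℤ} (hx : red n x = r) :
    red d x = r := by
  obtain ⟨m, hm⟩ := exists_int_red x {d, n}
  rw [hm n (by simp), ZMod.intCast_eq_intCast_iff_dvd_sub] at hx
  rw [hm d (by simp), ZMod.intCast_eq_intCast_iff_dvd_sub]
  exact (Int.natCast_dvd_natCast.2 (PNat.dvd_iff.1 h)).trans hx

lemma red_eq_zero_of_dvd {d n : ℕ+} (h : d ∣ n) {x : Zhat} (hx : red n x = 0) :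
    red d x = 0 := by
  simpa using red_eq_of_dvd (r := 0) h (by simpa using hx)

/-- Restriction of a profinite integer to the coordinates in `B`. -/
def toH (B : Set ℕ+) (x : Zhat) : H B :=
  ⟨fun b => red b x, by
    let f : ProdZMod Set.univ → ProdZMod B := fun g b => g ⟨b, trivial⟩
    have hf : Continuous f := continuous_pi fun b => continuous_apply _
    have hx : (x : ProdZMod Set.univ) ∈
      closure ((diag Set.univ).range : Set (ProdZMod Set.univ)) := x.2
    refine map_mem_closure hf hx ?_
    rintro _ ⟨m, rfl⟩
    exact ⟨m, rfl⟩⟩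

lemma toH_apply (B : Set ℕ+) (x : Zhat) (b : B) : (toH B x : ProdZMod B) b = red b x := rfl

lemma toH_add_Delta (B : Set ℕ+) (x : Zhat) (n : ℤ) :
    toH B x + Delta B n = toH B (x + toZhat n) := rfl

lemma continuous_toH (B : Set ℕ+) : Continuous (toH B) :=
  continuous_induced_rng.2 (continuous_pi fun b => continuous_red (b : ℕ+))

lemma map_toH (B : Set ℕ+) : haarZ.map (toH B) = haarH B := by
  have hm := (continuous_toH B).measurable
  have : IsProbabilityMeasure (haarZ.map (toH B)) :=
    Measure.isProbabilityMeasure_map hm.aemeasurable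
  refine eq_of_map_add_Delta_one ?_ (haarH_map_add_Delta_one B)
  have h1 : Measurable fun h : H B => h + Delta B 1 :=
    (continuous_id.add continuous_const).measurable
  have h2 : Measurable fun h : Zhat => h + toZhat 1 :=
    (continuous_id.add continuous_const).measurable
  rw [Measure.map_map h1 hm]
  have h3 : (fun h : H B => h + Delta B 1) ∘ toH B = toH B ∘ fun h => h + toZhat 1 := rfl
  rw [h3, ← Measure.map_map hm h2, haarH_map_add_Delta_one]

lemma continuous_affine (r : ℤ) (N : ℕ) : Continuous fun x : Zhat => toZhat r + N • x :=
  continuous_const.add (continuous_id.nsmul N)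

@[simp] lemma red_affine (n : ℕ+) (r : ℤ) (N : ℕ) (x : Zhat) :
    red n (toZhat r + N • x) = r + N * red n x := by
  rw [map_add, map_nsmul, red_toZhat, nsmul_eq_mul]

lemma haarZ_preimage_toZhat_add (k : ℤ) (E : Set Zhat) :
    haarZ {x | toZhat k + x ∈ E} = haarZ E :=
  measure_preimage_add haarZ (toZhat k) E

lemma haarZ_affine_add_mul (r j : ℤ) (N : ℕ) (E : Set Zhat) :
    haarZ {x | toZhat (r + N * j) + N • x ∈ E} = haarZ {x | toZhat r + N • x ∈ E} := by
  rw [← haarZ_preimage_toZhat_add j {x | toZhat r + N • x ∈ E}]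
  congr 1
  ext x
  simp only [Set.mem_ofPred_eq, smul_add, map_add, ← add_assoc]
  rw [← nsmul_eq_mul, map_nsmul]

/-- A uniform profinite integer is `r + N x` with `r` uniform modulo `N` and `x` an independent
uniform profinite integer. -/
lemma haarZ_eq_sum_affine (N : ℕ+) :
    haarZ = ∑ r ∈ Finset.range N, (N : ENNReal)⁻¹ •
      haarZ.map fun x => toZhat (r : ℤ) + (N : ℕ) • x := by
  have hm : ∀ r : ℤ, Measurable fun x : Zhat => toZhat r + (N : ℕ) • x :=
    fun r => (continuous_affine r N).measurable
  have h1 : Measurable fun h : Zhat => h + toZhat 1 :=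
    (continuous_id.add continuous_const).measurable
  have hN : ((N : ℕ) : ENNReal) ≠ 0 := by simp
  set ν := ∑ r ∈ Finset.range N, (N : ENNReal)⁻¹ •
      haarZ.map fun x => toZhat (r : ℤ) + (N : ℕ) • x with hν
  have hval : ∀ E, MeasurableSet E → ν E =
      ∑ r ∈ Finset.range N, (N : ENNReal)⁻¹ * haarZ {x | toZhat (r : ℤ) + (N : ℕ) • x ∈ E} := by
    intro E hE
    rw [hν, Measure.coe_finsetSum, Finset.sum_apply]
    refine Finset.sum_congr rfl fun r _ => ?_
    rw [Measure.smul_apply, Measure.map_apply (hm _) hE]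
    rfl
  have hprob : IsProbabilityMeasure ν := by
    refine ⟨?_⟩
    rw [hval _ MeasurableSet.univ]
    simp [ENNReal.mul_inv_cancel hN]
  refine eq_of_map_add_Delta_one (haarH_map_add_Delta_one _) ?_
  ext E hE
  rw [Measure.map_apply h1 hE, hval _ hE, hval _ (h1 hE)]
  -- Adding `1` permutes the residues cyclically, with a carry from `N - 1` to `0`.
  have hs : ∀ r : ℕ, haarZ {x | toZhat (r : ℤ) + (N : ℕ) • x ∈ (fun h => h + toZhat 1) ⁻¹' E}
      = haarZ {x | toZhat ((r + 1 : ℕ) : ℤ) + (N : ℕ) • x ∈ E} := by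
    intro r
    congr 1
    ext x
    simp only [Set.mem_ofPred_eq, Set.mem_preimage]
    push_cast
    rw [map_add, add_right_comm]
  simp only [hs]
  rw [← Finset.mul_sum, ← Finset.mul_sum]
  congr 1
  have e1 := Finset.sum_range_succ
    (fun r : ℕ => haarZ {x | toZhat (r : ℤ) + (N : ℕ) • x ∈ E}) N
  have e2 := Finset.sum_range_succ'
    (fun r : ℕ => haarZ {x | toZhat (r : ℤ) + (N : ℕ) • x ∈ E}) N
  have e3 : haarZ {x | toZhat (N : ℤ) + (N : ℕ) • x ∈ E}
      = haarZ {x | toZhat (0 : ℕ) + (N : ℕ) • x ∈ E} := by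
    have := haarZ_affine_add_mul 0 1 N E
    simpa using this
  rw [e2] at e1
  rw [e3] at e1
  exact (ENNReal.add_left_inj (measure_ne_top _ _)).1 e1

/-- Conditionally on being `≡ r` modulo `N`, a uniform profinite integer is distributed like
`r + N x`. -/
lemma haarZ_inter_residue (N : ℕ+) (r : ℤ) {E : Set Zhat} (hE : MeasurableSet E) :
    haarZ ({x | red N x = r} ∩ E) = haarZ {x | toZhat r + (N : ℕ) • x ∈ E} / N := by
  have hm : ∀ r : ℤ, Measurable fun x : Zhat => toZhat r + (N : ℕ) • x :=
    fun r => (continuous_affine r N).measurable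
  have hmeas : MeasurableSet ({x | red N x = r} ∩ E) :=
    (measurable_red N (measurableSet_singleton _)).inter hE
  have hN : (0 : ℤ) < (N : ℕ) := by exact_mod_cast N.pos
  conv_lhs => rw [haarZ_eq_sum_affine N]
  rw [Measure.coe_finsetSum, Finset.sum_apply]
  have hr0 : ((r % (N : ℕ)).toNat : ℤ) = r % (N : ℕ) := Int.toNat_of_nonneg (Int.emod_nonneg _ hN.ne')
  have hlt : (r % (N : ℕ)).toNat < (N : ℕ) := by
    have := Int.emod_lt_of_pos r hN
    omega
  rw [Finset.sum_eq_single_of_mem (r % (N : ℕ)).toNat (Finset.mem_range.2 hlt)]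
  · rw [Measure.smul_apply, Measure.map_apply (hm _) hmeas, smul_eq_mul, mul_comm, ← div_eq_mul_inv]
    congr 1
    have := haarZ_affine_add_mul (r % (N : ℕ)) (r / (N : ℕ)) N E
    rw [Int.emod_add_mul_ediv] at this
    rw [this]
    congr 1
    ext x
    simp [hr0]
  · intro s hs hne
    rw [Measure.smul_apply, Measure.map_apply (hm _) hmeas]
    have : (fun x : Zhat => toZhat (s : ℤ) + (N : ℕ) • x) ⁻¹' ({x | red N x = r} ∩ E) = ∅ := by
      ext x
      simp only [Set.mem_preimage, Set.mem_inter_iff, Set.mem_ofPred_eq, red_affine,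
        CharP.cast_eq_zero, zero_mul, add_zero, Set.mem_empty_iff_false, iff_false, not_and]
      intro h
      exfalso
      apply hne
      rw [ZMod.intCast_eq_intCast_iff] at h
      have h' : (s : ℤ) % (N : ℕ) = r % (N : ℕ) := h
      rw [Int.emod_eq_of_lt (by positivity) (by exact_mod_cast Finset.mem_range.1 hs)] at h'
      omega
    simp [this]

lemma haarZ_residue (N : ℕ+) (r : ℤ) : haarZ {x | red N x = r} = (N : ENNReal)⁻¹ := by
  simpa using haarZ_inter_residue N r MeasurableSet.univ

/-- An event whose probability is unchanged under all substitutions `x ↦ r + N x` is independent of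
the residue modulo `N`. -/
lemma haarZ_inter_of_affine_invariant {N : ℕ+} {E : Set Zhat} (hE : MeasurableSet E)
    (h : ∀ r : ℤ, haarZ {x | toZhat r + (N : ℕ) • x ∈ E} = haarZ E) (T : Set (ZMod N)) :
    haarZ (red N ⁻¹' T ∩ E) = haarZ (red N ⁻¹' T) * haarZ E := by
  classical
  have hT : T = (T.toFinset : Set (ZMod N)) := by simp
  have hms : ∀ y ∈ T.toFinset, MeasurableSet (red N ⁻¹' {y}) :=
    fun y _ => measurable_red N (measurableSet_singleton _)
  have e1 := sum_measure_preimage_singleton (μ := haarZ.restrict E) T.toFinset hms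
  have e2 := sum_measure_preimage_singleton (μ := haarZ) T.toFinset hms
  rw [← hT] at e1 e2
  rw [← Measure.restrict_apply (measurable_red N (MeasurableSet.of_discrete)), ← e1, ← e2,
    Finset.sum_mul]
  refine Finset.sum_congr rfl fun t _ => ?_
  rw [Measure.restrict_apply (measurable_red N (measurableSet_singleton _))]
  have ht : red N ⁻¹' {t} = {x | red N x = ((t.val : ℤ) : ZMod N)} := by
    ext x; simp
  rw [ht, haarZ_inter_residue N _ hE, h, haarZ_residue, div_eq_mul_inv, mul_comm]

/-! ### Sets of multiples in the profinite integers -/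

/-- The profinite integers which are divisible by some element of `A`. -/
def mult (A : Set ℕ+) : Set Zhat := {x | ∃ a ∈ A, red a x = 0}

lemma measurableSet_mult (A : Set ℕ+) : MeasurableSet (mult A) := by
  have : mult A = ⋃ a ∈ A, red a ⁻¹' {0} := by
    ext x; simp [mult]
  rw [this]
  exact MeasurableSet.biUnion A.to_countable fun a _ =>
    measurable_red a (measurableSet_singleton _)

lemma mult_mono {A A' : Set ℕ+} (h : A ⊆ A') : mult A ⊆ mult A' :=
  fun _ ⟨a, ha, hx⟩ => ⟨a, h ha, hx⟩

@[simp] lemma mult_empty : mult ∅ = ∅ := by ext x; simp [mult]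

@[simp] lemma toZhat_mem_mult {A : Set ℕ+} {n : ℤ} : toZhat n ∈ mult A ↔ n ∈ multiples A := by
  simp [mult, multiples, ZMod.intCast_zmod_eq_zero_iff_dvd]

/-- The elements of `A` which are at most `k`. -/
def trunc (A : Set ℕ+) (k : ℕ) : Set ℕ+ := {a ∈ A | (a : ℕ) ≤ k}

lemma trunc_subset (A : Set ℕ+) (k : ℕ) : trunc A k ⊆ A := fun _ h => h.1

lemma trunc_mono (A : Set ℕ+) : Monotone (trunc A) := fun _ _ h _ ha => ⟨ha.1, ha.2.trans h⟩

lemma dvd_factorial_of_mem_trunc {A : Set ℕ+} {k : ℕ} {a : ℕ+} (ha : a ∈ trunc A k) :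
    (a : ℕ) ∣ k.factorial := Nat.dvd_factorial a.pos ha.2

lemma mult_eq_iUnion_trunc (A : Set ℕ+) : mult A = ⋃ k, mult (trunc A k) := by
  ext x
  simp only [mult, trunc, Set.mem_iUnion, Set.mem_ofPred_eq]
  constructor
  · rintro ⟨a, ha, hx⟩; exact ⟨a, a, ⟨ha, le_rfl⟩, hx⟩
  · rintro ⟨k, a, ha, hx⟩; exact ⟨a, ha.1, hx⟩

lemma tendsto_haarZ_preimage_mult_trunc (A : Set ℕ+) (f : Zhat → Zhat) :
    Tendsto (fun k => haarZ (f ⁻¹' mult (trunc A k))) atTop (𝓝 (haarZ (f ⁻¹' mult A))) := by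
  rw [mult_eq_iUnion_trunc A, Set.preimage_iUnion]
  exact tendsto_measure_iUnion_atTop fun i j h =>
    Set.preimage_mono (mult_mono (trunc_mono A h))

lemma tendsto_haarZ_mult_trunc (A : Set ℕ+) :
    Tendsto (fun k => haarZ.real (mult (trunc A k))) atTop (𝓝 (haarZ.real (mult A))) :=
  (ENNReal.tendsto_toReal (measure_ne_top _ _)).comp (tendsto_haarZ_preimage_mult_trunc A id)

/-- If all elements of `A` are coprime to `z`, then `x` and `y + z x` have the same probability to
be a multiple of an element of `A`. -/
lemma haarZ_affine_mult {A : Set ℕ+} {z : ℕ} (hz : ∀ a ∈ A, z.Coprime a) (y : ℤ) :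
    haarZ {x | toZhat y + z • x ∈ mult A} = haarZ (mult A) := by
  have hfin : ∀ k, haarZ {x | toZhat y + z • x ∈ mult (trunc A k)} = haarZ (mult (trunc A k)) := by
    intro k
    have hAfin : (trunc A k).Finite :=
      (Set.finite_le_nat k).preimage PNat.coe_injective.injOn |>.subset fun a ha => ha.2
    set N := ∏ a ∈ hAfin.toFinset, (a : ℕ) with hN
    have hcop : z.Coprime N := by
      refine Nat.Coprime.prod_right fun a ha => hz a ?_
      exact ((Set.Finite.mem_toFinset _).1 ha).1
    obtain ⟨w, v, hwv⟩ : ∃ w v : ℤ, (1 : ℤ) = z * w + N * v :=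
      ⟨_, _, by rw [← Nat.gcd_eq_gcd_ab, hcop.gcd_eq_one]; rfl⟩
    rw [← haarZ_preimage_toZhat_add (w * y) (mult (trunc A k))]
    congr 1
    ext x
    simp only [mult, Set.mem_ofPred_eq, red_affine]
    refine exists_congr fun a => and_congr_right fun ha => ?_
    have haN : (a : ℕ) ∣ N :=
      Finset.dvd_prod_of_mem (fun a : ℕ+ => (a : ℕ)) ((Set.Finite.mem_toFinset _).2 ha)
    have h1 : (1 : ZMod a) = z * w := by
      have := congrArg (Int.cast : ℤ → ZMod a) hwv
      push_cast at this
      rw [(ZMod.natCast_eq_zero_iff N a).2 haN] at this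
      simpa using this
    rw [map_add, red_toZhat]
    push_cast
    constructor
    · intro h
      linear_combination (w : ZMod a) * h + red a x * h1
    · intro h
      linear_combination (z : ZMod a) * h + y * h1
  have t1 := tendsto_haarZ_preimage_mult_trunc A fun x => toZhat y + z • x
  have t2 := tendsto_haarZ_preimage_mult_trunc A id
  refine tendsto_nhds_unique t1 (t2.congr fun k => (hfin k).symm)

/-- Being free of multiples of integers coprime to `N` is independent of the residue
modulo `N`. -/
lemma haarZ_inter_mult_compl {N : ℕ+} {C : Set ℕ+} (hC : ∀ a ∈ C, (N : ℕ).Coprime a)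
    (T : Set (ZMod N)) :
    haarZ.real (red N ⁻¹' T ∩ (mult C)ᶜ) = haarZ.real (red N ⁻¹' T) * haarZ.real (mult C)ᶜ := by
  simp only [measureReal_def]
  rw [haarZ_inter_of_affine_invariant (measurableSet_mult C).compl, ENNReal.toReal_mul]
  intro r
  rw [prob_compl_eq_one_sub (measurableSet_mult C), ← haarZ_affine_mult hC r,
    ← prob_compl_eq_one_sub (s := {x | toZhat r + (N : ℕ) • x ∈ mult C})
      ((continuous_affine r N).measurable (measurableSet_mult C))]
  rfl

/-- The elements of `A` all of whose prime factors exceed `K`. -/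
def rough (A : Set ℕ+) (K : ℕ) : Set ℕ+ := {a ∈ A | ∀ p : ℕ, p.Prime → p ∣ (a : ℕ) → K < p}

lemma coprime_of_rough {A : Set ℕ+} {K N : ℕ} (hN : ∀ p : ℕ, p.Prime → p ∣ N → p ≤ K)
    {a : ℕ+} (ha : a ∈ rough A K) : N.Coprime a :=
  Nat.coprime_of_dvd fun p hp h1 h2 => absurd (ha.2 p hp h2) (not_lt.2 (hN p hp h1))

/-- `k!` as a positive natural number. -/
def pfact (k : ℕ) : ℕ+ := ⟨k.factorial, k.factorial_pos⟩

lemma factorial_coprime_of_rough {A : Set ℕ+} {K : ℕ} {a : ℕ+} (ha : a ∈ rough A K) :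
    ((pfact K : ℕ+) : ℕ).Coprime a :=
  coprime_of_rough (fun _ hp h => (hp.dvd_factorial).1 h) ha

/-- A zero-one law: unless almost everything is a multiple of an element of `A`, almost nothing
is a multiple of an element of `A` without small prime factors. -/
lemma tendsto_haarZ_mult_rough {A : Set ℕ+} (hA : haarZ.real (mult A) < 1) :
    Tendsto (fun K => haarZ.real (mult (rough A K))) atTop (𝓝 0) := by
  have hpos : 0 < haarZ.real (mult A)ᶜ := by
    rw [probReal_compl_eq_one_sub (measurableSet_mult A)]; linarith
  have hbound : ∀ k, haarZ.real (mult (rough A k)) ≤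
      1 - (1 - haarZ.real (mult A)) / (1 - haarZ.real (mult (trunc A k))) := by
    intro k
    set V : Set Zhat := (mult (trunc A k))ᶜ with hV
    have hVT : V = red (pfact k) ⁻¹' {t | ∀ a ∈ trunc A k, ¬ (a : ℕ) ∣ t.val} := by
      ext x
      have hm' : red (pfact k) x = (((red (pfact k) x).val : ℤ) : ZMod (pfact k)) := by simp
      simp only [hV, mult, Set.mem_compl_iff, Set.mem_ofPred_eq, Set.mem_preimage, not_exists,
        not_and]
      refine forall_congr' fun a => forall_congr' fun ha => not_congr ?_
      rw [red_eq_of_dvd (PNat.dvd_iff.2 (dvd_factorial_of_mem_trunc ha)) hm']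
      rw [Int.cast_natCast, ZMod.natCast_eq_zero_iff]
    have hind := haarZ_inter_mult_compl (N := pfact k) (C := rough A k)
      (fun a ha => factorial_coprime_of_rough ha) {t | ∀ a ∈ trunc A k, ¬ (a : ℕ) ∣ t.val}
    rw [← hVT] at hind
    have hle : haarZ.real (mult A)ᶜ ≤ haarZ.real (V ∩ (mult (rough A k))ᶜ) := by
      refine measureReal_mono (Set.subset_inter ?_ ?_)
      · exact Set.compl_subset_compl.2 (mult_mono (trunc_subset A k))
      · exact Set.compl_subset_compl.2 (mult_mono fun a ha => ha.1)
    have hVpos : 0 < haarZ.real V :=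
      hpos.trans_le (measureReal_mono (Set.compl_subset_compl.2 (mult_mono (trunc_subset A k))))
    rw [hind] at hle
    have e1 := probReal_compl_eq_one_sub (μ := haarZ) (measurableSet_mult A)
    have e2 := probReal_compl_eq_one_sub (μ := haarZ) (measurableSet_mult (trunc A k))
    have e3 := probReal_compl_eq_one_sub (μ := haarZ) (measurableSet_mult (rough A k))
    rw [← e1, ← e2]
    have : haarZ.real (mult A)ᶜ / haarZ.real V ≤ haarZ.real (mult (rough A k))ᶜ := by
      rw [div_le_iff₀ hVpos, mul_comm]; exact hle
    linarith
  have hlim : Tendsto (fun k => 1 - (1 - haarZ.real (mult A)) / (1 - haarZ.real (mult (trunc A k))))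
      atTop (𝓝 0) := by
    have h0 : 1 - haarZ.real (mult A) ≠ 0 := by linarith
    have := ((tendsto_haarZ_mult_trunc A).const_sub 1)
    have := (tendsto_const_nhds (x := 1 - haarZ.real (mult A))).div this h0
    rw [div_self h0] at this
    simpa using this.const_sub 1
  exact squeeze_zero (fun _ => measureReal_nonneg) hbound hlim

/-! ### A lower bound of Mertens type -/

/-- Obtained by comparing `n!` with its divisor `∏ p ^ (n / p)` and using the bound `4 ^ n` for the
primorial. -/
lemma sum_log_div_prime_le (n : ℕ) :
    ∑ p ∈ (n + 1).primesBelow, Real.log p / p ≤ Real.log n + Real.log 4 := by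
  rcases Nat.eq_zero_or_pos n with rfl | hn
  · simp [Nat.primesBelow, Real.log_nonneg, Finset.range_one, Finset.filter_singleton,
      Nat.not_prime_zero]
  have hpr : ∀ p ∈ (n + 1).primesBelow, p.Prime := fun p hp => Nat.prime_of_mem_primesBelow hp
  have hdvd : ∏ p ∈ (n + 1).primesBelow, p ^ (n / p) ∣ n.factorial := by
    refine Finset.prod_dvd_of_isRelPrime ?_ ?_
    · intro p hp q hq hpq
      exact Nat.coprime_iff_isRelPrime.1
        (Nat.Coprime.pow _ _ ((Nat.coprime_primes (hpr p hp) (hpr q hq)).2 hpq))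
    · intro p hp
      rw [(hpr p hp).pow_dvd_factorial_iff (b := Nat.log p n + 2) (by omega)]
      refine le_trans (by simp) (Finset.single_le_sum (f := fun i => n / p ^ i)
        (fun i _ => Nat.zero_le _) (Finset.mem_Ico.2 ⟨le_rfl, by omega⟩ : 1 ∈ _))
  have hle : ∏ p ∈ (n + 1).primesBelow, p ^ (n / p) ≤ n ^ n :=
    (Nat.le_of_dvd n.factorial_pos hdvd).trans (Nat.factorial_le_pow n)
  have hlog : ∑ p ∈ (n + 1).primesBelow, ((n / p : ℕ) : ℝ) * Real.log p ≤ n * Real.log n := by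
    have h1 : Real.log ((∏ p ∈ (n + 1).primesBelow, p ^ (n / p) : ℕ) : ℝ)
        ≤ Real.log ((n ^ n : ℕ) : ℝ) := by
      refine Real.log_le_log ?_ (by exact_mod_cast hle)
      exact_mod_cast Finset.prod_pos fun p hp => pow_pos (hpr p hp).pos _
    rw [Nat.cast_prod, Real.log_prod fun p hp => by
      exact_mod_cast (pow_pos (hpr p hp).pos _).ne'] at h1
    simpa [Real.log_pow] using h1
  have htheta : ∑ p ∈ (n + 1).primesBelow, Real.log p ≤ n * Real.log 4 := by
    have h1 : Real.log (primorial n : ℝ) ≤ Real.log ((4 ^ n : ℕ) : ℝ) :=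
      Real.log_le_log (by exact_mod_cast primorial_pos n) (by exact_mod_cast primorial_le_four_pow n)
    rw [primorial, Nat.cast_prod, Real.log_prod fun p hp => by
      exact_mod_cast (Finset.mem_filter.1 hp).2.ne_zero] at h1
    simpa [Real.log_pow, Nat.primesBelow] using h1
  have hn' : (0 : ℝ) < n := by exact_mod_cast hn
  have key : n * ∑ p ∈ (n + 1).primesBelow, Real.log p / p ≤ n * (Real.log n + Real.log 4) := by
    rw [Finset.mul_sum, mul_add]
    refine le_trans ?_ (add_le_add hlog htheta)
    rw [← Finset.sum_add_distrib]
    refine Finset.sum_le_sum fun p hp => ?_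
    have hp0 : (0 : ℝ) < p := by exact_mod_cast (hpr p hp).pos
    have hlp : 0 ≤ Real.log p := Real.log_natCast_nonneg p
    have : (n : ℝ) / p ≤ ((n / p : ℕ) : ℝ) + 1 := by
      have := Nat.lt_floor_add_one ((n : ℝ) / p)
      rw [Nat.floor_div_natCast, Nat.floor_natCast] at this
      exact this.le
    calc (n : ℝ) * (Real.log p / p) = (n : ℝ) / p * Real.log p := by ring
      _ ≤ (((n / p : ℕ) : ℝ) + 1) * Real.log p := by gcongr
      _ = _ := by ring
  exact le_of_mul_le_mul_left key hn'

lemma prod_one_sub_rpow_inv_le {s : ℝ} (hs : 1 < s) (N : ℕ) :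
    ∏ p ∈ N.primesBelow, (1 - (p : ℝ) ^ (-s))⁻¹ ≤ 1 + 1 / (s - 1) := by
  let f : ℕ →* ℝ :=
    { toFun := fun n => (n : ℝ) ^ (-s)
      map_one' := by simp
      map_mul' := fun m n => by
        push_cast
        exact Real.mul_rpow (by positivity) (by positivity) }
  have hf : ∀ {p : ℕ}, p.Prime → ‖f p‖ < 1 := by
    intro p hp
    change ‖(p : ℝ) ^ (-s)‖ < 1
    rw [Real.norm_of_nonneg (by positivity)]
    exact Real.rpow_lt_one_of_one_lt_of_neg (by exact_mod_cast hp.one_lt) (by linarith)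
  obtain ⟨-, h2⟩ := EulerProduct.summable_and_hasSum_smoothNumbers_prod_primesBelow_geometric hf N
  have hsum : Summable fun n : ℕ => (n : ℝ) ^ (-s) := Real.summable_nat_rpow.2 (by linarith)
  have hz := ZetaAsymptotics.zeta_limit_aux1 hs
  have hle : ∏ p ∈ N.primesBelow, (1 - (p : ℝ) ^ (-s))⁻¹ ≤ ∑' n : ℕ, (n : ℝ) ^ (-s) := by
    rw [show ∏ p ∈ N.primesBelow, (1 - (p : ℝ) ^ (-s))⁻¹ = _ from h2.tsum_eq.symm]
    exact hsum.tsum_subtype_le (fun n : ℕ => (n : ℝ) ^ (-s)) _ (fun n => by positivity)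
  have heq : ∑' n : ℕ, (n : ℝ) ^ (-s) = ∑' n : ℕ, 1 / ((n : ℝ) + 1) ^ s := by
    rw [hsum.tsum_eq_zero_add]
    rw [Nat.cast_zero, Real.zero_rpow (by linarith), zero_add]
    refine tsum_congr fun n => ?_
    rw [Real.rpow_neg (by positivity), one_div]
    push_cast
    rfl
  have hnn : 0 ≤ s * ZetaAsymptotics.termTSum s := by
    refine mul_nonneg (by linarith) (tsum_nonneg fun n => ?_)
    exact ZetaAsymptotics.term_nonneg _ _
  linarith

/-- An inequality of Mertens. The product is compared with the Euler product of `ζ(s)` at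
`s = 1 + 1 / log y`, where `ζ(s) ≤ 1 + log y`; the quotient of the two is bounded because
`∑ log p / p ≤ log y + log 4` over the primes up to `y`. -/
lemma exists_mertens_bound : ∃ c : ℝ, 0 < c ∧ ∀ y : ℕ, 2 ≤ y →
    c ≤ Real.log y * ∏ p ∈ (y + 1).primesBelow, (1 - (p : ℝ)⁻¹) := by
  refine ⟨Real.exp (-6) / 3, by positivity, fun y hy => ?_⟩
  have hpr : ∀ p ∈ (y + 1).primesBelow, p.Prime := fun p hp => Nat.prime_of_mem_primesBelow hp
  have hl2 : 0.69 < Real.log 2 := by have := Real.log_two_gt_d9; linarith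
  have hly : Real.log 2 ≤ Real.log y := Real.log_le_log (by norm_num) (by exact_mod_cast hy)
  have hl4 : Real.log 4 = 2 * Real.log 2 := by
    rw [show (4 : ℝ) = 2 ^ 2 by norm_num, Real.log_pow]; norm_num
  set l := Real.log y with hl
  have hlpos : 0 < l := by linarith
  set s : ℝ := 1 + 1 / l with hs
  have hs1 : s - 1 = 1 / l := by rw [hs]; ring
  have hs' : 1 < s := by have : 0 < 1 / l := by positivity
                         linarith
  have hfac : ∀ p ∈ (y + 1).primesBelow,
      1 - (p : ℝ) ^ (-s) ≤ (1 - (p : ℝ)⁻¹) * Real.exp (2 / l * (Real.log p / p)) := by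
    intro p hp
    have hp2 : (2 : ℝ) ≤ p := by exact_mod_cast (hpr p hp).two_le
    have hp0 : (0 : ℝ) < p := by linarith
    have hinv : (p : ℝ)⁻¹ ≤ 1 / 2 := by rw [inv_le_comm₀ hp0 (by norm_num)]; linarith
    have hinv0 : 0 < (p : ℝ)⁻¹ := by positivity
    have e1 : (p : ℝ) ^ (-s) = (p : ℝ)⁻¹ * Real.exp (-(Real.log p / l)) := by
      rw [Real.rpow_def_of_pos hp0, hs]
      rw [← Real.exp_log hinv0, Real.log_inv, ← Real.exp_add]
      congr 1
      ring
    have e2 : 1 - Real.log p / l ≤ Real.exp (-(Real.log p / l)) := by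
      have := Real.add_one_le_exp (-(Real.log p / l)); linarith
    have e3 : 1 + 2 / l * (Real.log p / p) ≤ Real.exp (2 / l * (Real.log p / p)) := by
      have := Real.add_one_le_exp (2 / l * (Real.log p / p)); linarith
    have hlp : 0 ≤ Real.log p / l := div_nonneg (Real.log_natCast_nonneg p) hlpos.le
    have e4 : 2 / l * (Real.log p / p) = 2 * (Real.log p / l) * (p : ℝ)⁻¹ := by
      field_simp
    rw [e4] at e3
    rw [e1, e4]
    calc 1 - (p : ℝ)⁻¹ * Real.exp (-(Real.log p / l))
        ≤ 1 - (p : ℝ)⁻¹ * (1 - Real.log p / l) := by gcongr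
      _ ≤ (1 - (p : ℝ)⁻¹) * (1 + 2 * (Real.log p / l) * (p : ℝ)⁻¹) := by
        have : 0 ≤ (Real.log p / l) * (p : ℝ)⁻¹ * (1 / 2 - (p : ℝ)⁻¹) := by
          refine mul_nonneg (by positivity) (by linarith)
        nlinarith
      _ ≤ _ := by
        refine mul_le_mul_of_nonneg_left e3 (by linarith)
  have hprod : ∏ p ∈ (y + 1).primesBelow, (1 - (p : ℝ) ^ (-s)) ≤
      (∏ p ∈ (y + 1).primesBelow, (1 - (p : ℝ)⁻¹)) * Real.exp 6 := by
    have hnn : ∀ p ∈ (y + 1).primesBelow, 0 ≤ 1 - (p : ℝ) ^ (-s) := by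
      intro p hp
      have := Real.rpow_lt_one_of_one_lt_of_neg (x := (p : ℝ)) (z := -s)
        (by exact_mod_cast (hpr p hp).one_lt) (by linarith)
      linarith
    have hnn' : ∀ p ∈ (y + 1).primesBelow, 0 ≤ 1 - (p : ℝ)⁻¹ := by
      intro p hp
      have : (p : ℝ)⁻¹ ≤ 1 := inv_le_one_of_one_le₀ (by exact_mod_cast (hpr p hp).one_le)
      linarith
    refine (Finset.prod_le_prod hnn hfac).trans ?_
    rw [Finset.prod_mul_distrib, ← Real.exp_sum, ← Finset.mul_sum]
    refine mul_le_mul_of_nonneg_left (Real.exp_le_exp.2 ?_) (Finset.prod_nonneg hnn')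
    calc 2 / l * ∑ p ∈ (y + 1).primesBelow, Real.log p / p
        ≤ 2 / l * (l + Real.log 4) := by
          gcongr; exact sum_log_div_prime_le y
      _ ≤ 2 / l * (3 * l) := by gcongr; linarith
      _ = 6 := by field_simp; norm_num
  have hz := prod_one_sub_rpow_inv_le hs' (y + 1)
  rw [Finset.prod_inv_distrib, hs1, one_div_one_div] at hz
  have hpos : 0 < ∏ p ∈ (y + 1).primesBelow, (1 - (p : ℝ) ^ (-s)) := by
    refine Finset.prod_pos fun p hp => ?_
    have := Real.rpow_lt_one_of_one_lt_of_neg (x := (p : ℝ)) (z := -s)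
      (by exact_mod_cast (hpr p hp).one_lt) (by linarith)
    linarith
  have h3 : 1 ≤ 3 * l * ∏ p ∈ (y + 1).primesBelow, (1 - (p : ℝ) ^ (-s)) := by
    rw [inv_le_iff_one_le_mul₀ hpos] at hz
    refine hz.trans (mul_le_mul_of_nonneg_right (by linarith) hpos.le)
  have h4 : 1 ≤ 3 * l * ((∏ p ∈ (y + 1).primesBelow, (1 - (p : ℝ)⁻¹)) * Real.exp 6) :=
    h3.trans (mul_le_mul_of_nonneg_left hprod (by positivity))
  rw [Real.exp_neg, div_le_iff₀ (by norm_num), inv_le_iff_one_le_mul₀ (Real.exp_pos _)]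
  linarith

/-! ### Profinite integers without small prime factors -/

/-- The primes up to `y`. -/
def primesUpTo (y : ℕ) : Set ℕ+ := {p | (p : ℕ).Prime ∧ (p : ℕ) ≤ y}

lemma haarZ_mult_primesUpTo_compl (y : ℕ) :
    haarZ.real (mult (primesUpTo y))ᶜ = ∏ p ∈ (y + 1).primesBelow, (1 - (p : ℝ)⁻¹) := by
  induction y with
  | zero =>
    have : primesUpTo 0 = ∅ := by ext p; simp [primesUpTo]
    simp [this, Nat.primesBelow, Finset.filter_singleton, Nat.not_prime_zero]
  | succ y ih =>
    by_cases hp : (y + 1).Prime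
    · rw [Nat.primesBelow_succ, if_pos hp, Finset.prod_insert (by simp [Nat.primesBelow]), ← ih]
      let q : ℕ+ := ⟨y + 1, hp.pos⟩
      have h1 := haarZ_inter_mult_compl (N := q) (C := primesUpTo y) (fun a ha => by
        refine (Nat.coprime_primes hp ha.1).2 ?_
        have := ha.2
        show y + 1 ≠ _
        omega) {0}ᶜ
      have h2 : (mult (primesUpTo (y + 1)))ᶜ = red q ⁻¹' {0}ᶜ ∩ (mult (primesUpTo y))ᶜ := by
        rw [Set.preimage_compl, ← Set.compl_union]
        congr 1
        ext x
        simp only [mult, primesUpTo, Set.mem_ofPred_eq, Set.mem_union, Set.mem_preimage,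
          Set.mem_singleton_iff]
        constructor
        · rintro ⟨a, ⟨ha1, ha2⟩, hx⟩
          rcases Nat.lt_or_eq_of_le ha2 with h | h
          · exact Or.inr ⟨a, ⟨ha1, by omega⟩, hx⟩
          · have : a = q := PNat.eq h
            exact Or.inl (this ▸ hx)
        · rintro (hx | ⟨a, ⟨ha1, ha2⟩, hx⟩)
          · exact ⟨q, ⟨hp, le_rfl⟩, hx⟩
          · exact ⟨a, ⟨ha1, by omega⟩, hx⟩
      rw [h2, h1]
      congr 1
      rw [Set.preimage_compl, probReal_compl_eq_one_sub (measurable_red q (measurableSet_singleton _)),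
        measureReal_def]
      have h3 := haarZ_residue q 0
      rw [Int.cast_zero] at h3
      rw [show red q ⁻¹' {0} = {x | red q x = 0} from rfl, h3, ENNReal.toReal_inv,
        ENNReal.toReal_natCast]
      rfl
    · rw [Nat.primesBelow_succ, if_neg hp, ← ih]
      have : primesUpTo (y + 1) = primesUpTo y := by
        ext p
        simp only [primesUpTo, Set.mem_ofPred_eq]
        refine and_congr_right fun h => ⟨fun h' => ?_, fun h' => by omega⟩
        rcases Nat.lt_or_eq_of_le h' with h'' | h''
        · omega
        · exact absurd (h'' ▸ h) hp
      rw [this]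

/-- The profinite integers whose largest divisor composed of primes up to `y` is `n`
(for `n` composed of primes up to `y`). -/
def smoothPart (y : ℕ) (n : ℕ+) : Set Zhat :=
  {x | red n x = 0 ∧ ∀ p ∈ primesUpTo y, red (n * p) x ≠ 0}

lemma exists_int_red_of_dvd (x : Zhat) (N : ℕ+) :
    ∃ m : ℤ, ∀ d : ℕ+, d ∣ N → red d x = m := by
  obtain ⟨m, hm⟩ := exists_int_red x {N}
  exact ⟨m, fun d hd => red_eq_of_dvd hd (hm N (by simp))⟩

lemma red_mul_nsmul_eq_zero {n p : ℕ+} {x : Zhat} :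
    red (n * p) ((n : ℕ) • x) = 0 ↔ red p x = 0 := by
  obtain ⟨m, hm⟩ := exists_int_red_of_dvd x (n * p)
  rw [map_nsmul, hm _ dvd_rfl, hm p (Dvd.intro_left n rfl), nsmul_eq_mul]
  have : ((n : ℕ) : ZMod (n * p : ℕ+)) * (m : ZMod (n * p : ℕ+)) = (((n : ℕ) * m : ℤ) : ZMod _) := by
    rw [Int.cast_mul, Int.cast_natCast]
  rw [this, ZMod.intCast_zmod_eq_zero_iff_dvd, ZMod.intCast_zmod_eq_zero_iff_dvd, PNat.mul_coe,
    Nat.cast_mul]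
  exact mul_dvd_mul_iff_left (by exact_mod_cast n.ne_zero)

lemma measurableSet_smoothPart_aux (y : ℕ) (n : ℕ+) :
    MeasurableSet {x : Zhat | ∀ p ∈ primesUpTo y, red (n * p) x ≠ 0} := by
  have : {x : Zhat | ∀ p ∈ primesUpTo y, red (n * p) x ≠ 0}
      = (mult ((n * ·) '' primesUpTo y))ᶜ := by
    ext x; simp [mult]
  rw [this]
  exact (measurableSet_mult _).compl

lemma measurableSet_smoothPart (y : ℕ) (n : ℕ+) : MeasurableSet (smoothPart y n) :=
  (measurable_red n (measurableSet_singleton 0)).inter (measurableSet_smoothPart_aux y n)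

/-- The part of a random profinite integer composed of primes up to `y` equals `n` with
probability proportional to `1 / n`. -/
lemma haarZ_smoothPart (y : ℕ) (n : ℕ+) :
    haarZ.real (smoothPart y n) = haarZ.real (mult (primesUpTo y))ᶜ * (n : ℝ)⁻¹ := by
  have h := haarZ_inter_residue n 0 (measurableSet_smoothPart_aux y n)
  have h1 : smoothPart y n = {x | red n x = ((0 : ℤ) : ZMod n)} ∩
      {x : Zhat | ∀ p ∈ primesUpTo y, red (n * p) x ≠ 0} := by
    ext x; simp [smoothPart]
  have h2 : {x : Zhat | toZhat 0 + (n : ℕ) • x ∈ {x : Zhat | ∀ p ∈ primesUpTo y, red (n * p) x ≠ 0}}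
      = (mult (primesUpTo y))ᶜ := by
    ext x
    simp only [map_zero, zero_add, Set.mem_ofPred_eq, ne_eq, red_mul_nsmul_eq_zero, mult,
      Set.mem_compl_iff, not_exists, not_and]
  rw [h2, ← h1] at h
  rw [measureReal_def, h, ENNReal.toReal_div, ENNReal.toReal_natCast, div_eq_mul_inv, measureReal_def]

/-- Small divisors of a profinite integer divide its smooth part. -/
lemma dvd_of_mem_smoothPart {y : ℕ} {n m : ℕ+} {x : Zhat} (hx : x ∈ smoothPart y n)
    (hm : red m x = 0) (hmy : (m : ℕ) ≤ y) : m ∣ n := by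
  obtain ⟨k, hk⟩ := exists_int_red_of_dvd x (n * m * pfact y)
  have hn : ((n : ℕ) : ℤ) ∣ k := by
    rw [← ZMod.intCast_zmod_eq_zero_iff_dvd, ← hk n (by rw [mul_assoc]; exact Dvd.intro _ rfl)]
    exact hx.1
  have hm' : ((m : ℕ) : ℤ) ∣ k := by
    rw [← ZMod.intCast_zmod_eq_zero_iff_dvd,
      ← hk m (by rw [mul_comm n, mul_assoc]; exact Dvd.intro _ rfl)]
    exact hm
  obtain ⟨j, rfl⟩ := hn
  have hp : ∀ p ∈ primesUpTo y, ¬ ((p : ℕ) : ℤ) ∣ j := by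
    intro p hp hpj
    refine hx.2 p hp ?_
    have hpd : p ∣ pfact y := PNat.dvd_iff.2 (Nat.dvd_factorial p.pos hp.2)
    rw [hk (n * p) (by rw [mul_right_comm]; exact (mul_dvd_mul_left n hpd).mul_right m),
      ZMod.intCast_zmod_eq_zero_iff_dvd]
    push_cast
    exact mul_dvd_mul_left _ hpj
  have hcop : IsCoprime ((m : ℕ) : ℤ) j := by
    rw [Int.isCoprime_iff_gcd_eq_one, Int.gcd, Int.natAbs_natCast]
    refine Nat.coprime_of_dvd fun p hpp h1 h2 => ?_
    exact hp ⟨p, hpp.pos⟩ ⟨hpp, (Nat.le_of_dvd m.pos h1).trans hmy⟩ (Int.natCast_dvd.2 h2)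
  exact PNat.dvd_iff.2 (Int.natCast_dvd_natCast.1 (hcop.dvd_of_dvd_mul_right hm'))

open Classical in
/-- The sum of the reciprocals of the elements of `A` up to `n`. -/
def reciprocalSum (A : Set ℤ) (n : ℕ) : ℝ :=
  ∑ k ∈ Finset.Icc 1 n, if (k : ℤ) ∈ A then (k : ℝ)⁻¹ else 0

lemma reciprocalSum_nonneg (A : Set ℤ) (n : ℕ) : 0 ≤ reciprocalSum A n :=
  Finset.sum_nonneg fun k _ => by split_ifs <;> positivity

lemma reciprocalSum_diff {A A' : Set ℤ} (h : A' ⊆ A) (n : ℕ) :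
    reciprocalSum A n = reciprocalSum A' n + reciprocalSum (A \ A') n := by
  classical
  unfold reciprocalSum
  rw [← Finset.sum_add_distrib]
  refine Finset.sum_congr rfl fun k _ => ?_
  by_cases h1 : (k : ℤ) ∈ A' <;> by_cases h2 : (k : ℤ) ∈ A <;> simp [h1, h2]
  exact absurd (h h1) h2

/-- The events that the `y`-smooth part of a random profinite integer is `n`, for the `n ≤ y`
divisible by an element of `B` but by none that is at most `K`, are disjoint, and at each of them
the random integer itself has these divisibility properties. -/
lemma mul_reciprocalSum_diff_le (B : Set ℕ+) {K y : ℕ} (hKy : K ≤ y) :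
    haarZ.real (mult (primesUpTo y))ᶜ *
      reciprocalSum (multiples B \ multiples (trunc B K)) y ≤
      haarZ.real (mult B) - haarZ.real (mult (trunc B K)) := by
  classical
  set T := multiples B \ multiples (trunc B K) with hT
  set s := (Finset.Icc 1 y).filter fun k : ℕ => (k : ℤ) ∈ T with hs
  have hcoe : ∀ k ∈ s, ((Nat.toPNat' k : ℕ+) : ℕ) = k := by
    intro k hk
    rw [hs, Finset.mem_filter, Finset.mem_Icc] at hk
    rw [Nat.toPNat'_coe, if_pos (by omega)]
  have hle : ∀ k ∈ s, k ≤ y := fun k hk => (Finset.mem_Icc.1 (Finset.mem_filter.1 hk).1).2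
  have h1 : haarZ.real (mult (primesUpTo y))ᶜ * reciprocalSum T y
      = ∑ k ∈ s, haarZ.real (smoothPart y k.toPNat') := by
    rw [reciprocalSum, hs, Finset.sum_filter, Finset.mul_sum]
    refine Finset.sum_congr rfl fun k hk => ?_
    by_cases hkT : (k : ℤ) ∈ T
    · rw [if_pos hkT, if_pos hkT, haarZ_smoothPart, hcoe k (Finset.mem_filter.2 ⟨hk, hkT⟩)]
    · rw [if_neg hkT, if_neg hkT, mul_zero]
  have hdisj : (s : Set ℕ).PairwiseDisjoint fun k => smoothPart y k.toPNat' := by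
    intro k hk l hl hkl
    refine Set.disjoint_left.2 fun x hx hx' => hkl ?_
    have d1 := dvd_of_mem_smoothPart hx hx'.1 (by rw [hcoe l hl]; exact hle l hl)
    have d2 := dvd_of_mem_smoothPart hx' hx.1 (by rw [hcoe k hk]; exact hle k hk)
    have := PNat.dvd_antisymm d2 d1
    rw [← hcoe k hk, ← hcoe l hl, this]
  rw [h1, ← measureReal_biUnion_finset hdisj fun k _ => measurableSet_smoothPart y _,
    ← measureReal_sdiff (mult_mono (trunc_subset B K)) (measurableSet_mult _)]
  refine measureReal_mono ?_
  intro x hx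
  simp only [Set.mem_iUnion, exists_prop] at hx
  obtain ⟨k, hk, hx⟩ := hx
  have hkT : (k : ℤ) ∈ T := (Finset.mem_filter.1 hk).2
  have hdvd : ∀ b : ℕ+, b ∣ k.toPNat' ↔ ((b : ℕ) : ℤ) ∣ k := by
    intro b
    rw [PNat.dvd_iff, hcoe k hk, Int.natCast_dvd_natCast]
  obtain ⟨⟨b, hb, hbk⟩, hnot⟩ := hkT
  refine ⟨⟨b, hb, red_eq_zero_of_dvd ((hdvd b).2 hbk) hx.1⟩, ?_⟩
  rintro ⟨b', hb', hx'⟩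
  exact hnot ⟨b', hb', (hdvd b').1 (dvd_of_mem_smoothPart hx hx' (hb'.2.trans hKy))⟩

/-! ### Densities -/

open Classical in
/-- The number of elements of `A` in `{1, …, n}`. -/
def count (A : Set ℤ) (n : ℕ) : ℕ := ((Finset.Icc 1 n).filter fun k : ℕ => (k : ℤ) ∈ A).card

lemma count_le (A : Set ℤ) (n : ℕ) : count A n ≤ n := by
  classical
  exact (Finset.card_filter_le _ _).trans (by simp)

/-- The integer points of a clopen set of period `N` are counted up to an error `N` by its
measure. -/
lemma abs_count_sub_le {B : Set ℕ+} {V : Set (H B)} (hV : IsClopen V) {N : ℕ} (hN0 : N ≠ 0)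
    (hN : ∀ h, h + Delta B N ∈ V ↔ h ∈ V) (n : ℕ) :
    |(count (Delta B ⁻¹' V) n : ℝ) - n * (haarH B).real V| ≤ N := by
  classical
  set A := Delta B ⁻¹' V with hA
  have hper : ∀ k : ℤ, k + N ∈ A ↔ k ∈ A := fun k => by
    rw [hA, Set.mem_preimage, map_add]; exact hN _
  have hperN : Function.Periodic (fun k : ℕ => (k : ℤ) ∈ A) N := fun k => by
    have := hper k
    simpa using this
  have hN' : (0 : ℝ) < N := by positivity
  have hc : (Nat.count (fun k : ℕ => (k : ℤ) ∈ A) N : ℝ) = N * (haarH B).real V := by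
    rw [measureReal_def, measure_of_periodic (haarH_map_add_Delta_one B) hV hN0 hN,
      ENNReal.toReal_div, ENNReal.toReal_natCast, ENNReal.toReal_natCast, Nat.count_eq_card_filter_range]
    field_simp
    rfl
  have hIcc : ∀ n, count A n = ((Finset.Ico 1 (1 + n)).filter fun k : ℕ => (k : ℤ) ∈ A).card := by
    intro n
    rw [count]
    congr 2
    ext k; simp; omega
  have hstep : ∀ n, (count A (n + N) : ℝ) = count A n + N * (haarH B).real V := by
    intro n
    rw [← hc, ← Nat.filter_Ico_card_eq_of_periodic (1 + n) N _ hperN, hIcc, hIcc, ← Nat.cast_add,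
      ← Finset.card_union_of_disjoint, ← Finset.filter_union]
    · congr 3
      rw [← add_assoc]
      exact (Finset.Ico_union_Ico_eq_Ico (by omega) (by omega)).symm
    · exact Finset.disjoint_filter_filter (Finset.Ico_disjoint_Ico_consecutive _ _ _)
  induction n using Nat.strong_induction_on with
  | _ n ih =>
    by_cases hn : n < N
    · have h1 : (count A n : ℝ) ≤ n := by exact_mod_cast count_le A n
      have h2 : (haarH B).real V ≤ 1 := measureReal_le_one
      have h3 : 0 ≤ (haarH B).real V := measureReal_nonneg
      have h4 : (n : ℝ) ≤ N := by exact_mod_cast hn.le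
      have h5 : (0 : ℝ) ≤ n := by positivity
      have h6 : (0 : ℝ) ≤ count A n := by positivity
      rw [abs_le]
      constructor <;> nlinarith
    · obtain ⟨m, rfl⟩ := Nat.exists_eq_add_of_le (not_lt.1 hn)
      have := ih m (by omega)
      rw [add_comm N m, hstep]
      push_cast
      convert this using 2
      ring

/-- Partial summation: a lower bound for the sums of `f k` is inherited by the sums of
`f k / k`. -/
lemma neg_le_sum_div {f : ℕ → ℝ} {c : ℝ} (h : ∀ n, -c ≤ ∑ k ∈ Finset.Icc 1 n, f k) (n : ℕ) :
    -c ≤ ∑ k ∈ Finset.Icc 1 n, f k / k := by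
  have key : ∀ n : ℕ, -c * (1 - 1 / ((n : ℝ) + 1)) ≤
      ∑ k ∈ Finset.Icc 1 n, f k / k - (∑ k ∈ Finset.Icc 1 n, f k) / ((n : ℝ) + 1) := by
    intro n
    induction n with
    | zero => simp
    | succ n ih =>
      rw [Finset.sum_Icc_succ_top (by omega)]
      have h1 := h (n + 1)
      have h2 : ∑ k ∈ Finset.Icc 1 (n + 1), f k = ∑ k ∈ Finset.Icc 1 n, f k + f (n + 1) :=
        Finset.sum_Icc_succ_top (by omega) _
      have h3 : 0 ≤ (∑ k ∈ Finset.Icc 1 (n + 1), f k + c) * (1 / ((n : ℝ) + 1) - 1 / ((n : ℝ) + 2)) := by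
        refine mul_nonneg (by linarith) (sub_nonneg.2 ?_)
        exact one_div_le_one_div_of_le (by positivity) (by linarith)
      have h4 : (∑ k ∈ Finset.Icc 1 (n + 1), f k) / ((n : ℝ) + 1)
          = (∑ k ∈ Finset.Icc 1 n, f k) / ((n : ℝ) + 1) + f (n + 1) / ((n : ℝ) + 1) := by
        rw [h2, add_div]
      have h5 : ((n + 1 : ℕ) : ℝ) + 1 = n + 2 := by push_cast; ring
      rw [h5]
      push_cast
      rw [show ∀ a b c' : ℝ, (a + c) * (1 / b - 1 / c') = a / b - a / c' + c * (1 / b - 1 / c') from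
        fun a b c' => by ring] at h3
      linarith
  have h1 := key n
  have h2 := h n
  have h3 : -c / ((n : ℝ) + 1) ≤ (∑ k ∈ Finset.Icc 1 n, f k) / ((n : ℝ) + 1) := by gcongr
  have h4 : -c * (1 - 1 / ((n : ℝ) + 1)) + -c / ((n : ℝ) + 1) = -c := by ring
  linarith

lemma le_reciprocalSum {A : Set ℤ} {α c : ℝ} (h : ∀ n, α * n - c ≤ count A n) (n : ℕ) :
    α * (harmonic n : ℝ) - c ≤ reciprocalSum A n := by
  classical
  have := neg_le_sum_div (f := fun k => (if (k : ℤ) ∈ A then 1 else 0) - α) (c := c) (fun n => by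
    have := h n
    simp only [Finset.sum_sub_distrib, Finset.sum_boole, Finset.sum_const, Nat.card_Icc]
    rw [count] at this
    simp only [add_tsub_cancel_right, nsmul_eq_mul]
    linarith) n
  simp only [sub_div, Finset.sum_sub_distrib, ite_div, zero_div, one_div] at this
  rw [reciprocalSum, harmonic_eq_sum_Icc]
  push_cast
  rw [Finset.mul_sum]
  simp only [div_eq_mul_inv] at this
  linarith

lemma reciprocalSum_le {A : Set ℤ} {α c : ℝ} (h : ∀ n, count A n ≤ α * n + c) (n : ℕ) :
    reciprocalSum A n ≤ α * (harmonic n : ℝ) + c := by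
  classical
  have := neg_le_sum_div (f := fun k => α - (if (k : ℤ) ∈ A then 1 else 0)) (c := c) (fun n => by
    have := h n
    simp only [Finset.sum_sub_distrib, Finset.sum_boole, Finset.sum_const, Nat.card_Icc]
    rw [count] at this
    simp only [add_tsub_cancel_right, nsmul_eq_mul]
    linarith) n
  simp only [sub_div, Finset.sum_sub_distrib, ite_div, zero_div, one_div] at this
  rw [reciprocalSum, harmonic_eq_sum_Icc]
  push_cast
  rw [Finset.mul_sum]
  simp only [div_eq_mul_inv] at this
  linarith

lemma tendsto_log_natCast_atTop : Tendsto (fun n : ℕ => Real.log n) atTop atTop :=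
  Real.tendsto_log_atTop.comp tendsto_natCast_atTop_atTop

lemma tendsto_harmonic_div_log (α c : ℝ) :
    Tendsto (fun n : ℕ => (α * (harmonic n : ℝ) + c) / Real.log n) atTop (𝓝 α) := by
  have h1 := (Real.tendsto_harmonic_sub_log.const_mul α).add_const c
  have h2 := (h1.div_atTop tendsto_log_natCast_atTop).const_add α
  rw [add_zero] at h2
  refine h2.congr' ?_
  filter_upwards [eventually_gt_atTop 1] with n hn
  have : 0 < Real.log n := Real.log_pos (by exact_mod_cast hn)
  field_simp
  ring

lemma logAverage_eq (A : Set ℤ) (n : ℕ) : logAverage A n = reciprocalSum A n / Real.log n := rfl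

lemma isClopen_mult {A : Set ℕ+} (hA : A.Finite) : IsClopen (mult A) := by
  have : mult A = ⋃ a ∈ A, red a ⁻¹' {0} := by
    ext x; simp [mult]
  rw [this]
  exact hA.isClopen_biUnion fun a _ => (isClopen_discrete _).preimage (continuous_red a)

lemma finite_trunc (A : Set ℕ+) (k : ℕ) : (trunc A k).Finite :=
  ((Set.finite_le_nat k).preimage PNat.coe_injective.injOn).subset fun _ ha => ha.2

lemma red_add_toZhat_factorial {A : Set ℕ+} {k : ℕ} {a : ℕ+} (ha : a ∈ trunc A k) (x : Zhat) :
    red a (x + toZhat (k.factorial : ℕ)) = red a x := by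
  rw [map_add, red_toZhat, Int.cast_natCast,
    (ZMod.natCast_eq_zero_iff _ _).2 (dvd_factorial_of_mem_trunc ha), add_zero]

lemma abs_count_multiples_trunc_sub_le (A : Set ℕ+) (k n : ℕ) :
    |(count (multiples (trunc A k)) n : ℝ) - n * haarZ.real (mult (trunc A k))|
      ≤ k.factorial := by
  have h := abs_count_sub_le (isClopen_mult (finite_trunc A k)) k.factorial_ne_zero (fun x => by
    refine exists_congr fun a => and_congr_right fun ha => ?_
    rw [red_add_toZhat_factorial ha]) n
  have e : Delta Set.univ ⁻¹' mult (trunc A k) = multiples (trunc A k) := by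
    ext m; exact toZhat_mem_mult
  rwa [e] at h

lemma tendsto_logAverage_trunc (A : Set ℕ+) (k : ℕ) :
    Tendsto (logAverage (multiples (trunc A k))) atTop (𝓝 (haarZ.real (mult (trunc A k)))) := by
  set α := haarZ.real (mult (trunc A k))
  have h := abs_count_multiples_trunc_sub_le A k
  refine tendsto_of_tendsto_of_tendsto_of_le_of_le' (tendsto_harmonic_div_log α (-k.factorial))
    (tendsto_harmonic_div_log α k.factorial) ?_ ?_
  · refine Eventually.of_forall fun n => div_le_div_of_nonneg_right ?_ (Real.log_natCast_nonneg n)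
    have := le_reciprocalSum (A := multiples (trunc A k)) (α := α) (c := k.factorial) (fun n => by
      have := (abs_le.1 (h n)).1
      linarith) n
    exact this
  · refine Eventually.of_forall fun n => div_le_div_of_nonneg_right ?_ (Real.log_natCast_nonneg n)
    exact reciprocalSum_le (fun n => by
      have := (abs_le.1 (h n)).2
      linarith) n

lemma multiples_mono {A A' : Set ℕ+} (h : A ⊆ A') : multiples A ⊆ multiples A' :=
  fun _ ⟨a, ha, hx⟩ => ⟨a, h ha, hx⟩

/-- The Davenport–Erdős theorem: the logarithmic density of a set of multiples exists and is the
limit of the densities of the sets of multiples of the finite truncations. -/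
theorem tendsto_logAverage_multiples (A : Set ℕ+) :
    Tendsto (logAverage (multiples A)) atTop (𝓝 (haarZ.real (mult A))) := by
  obtain ⟨c, hc, hmertens⟩ := exists_mertens_bound
  rw [Metric.tendsto_atTop']
  intro ε hε
  set η := ε / (2 + c⁻¹) with hη
  have hη0 : 0 < η := by positivity
  obtain ⟨K, hK⟩ := ((tendsto_haarZ_mult_trunc A).eventually
    (lt_mem_nhds (sub_lt_self (haarZ.real (mult A)) hη0))).exists
  have hKle : haarZ.real (mult (trunc A K)) ≤ haarZ.real (mult A) :=
    measureReal_mono (mult_mono (trunc_subset A K))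
  obtain ⟨M, hM⟩ := (Metric.tendsto_atTop'.1 (tendsto_logAverage_trunc A K)) η hη0
  refine ⟨max M (max K 2), fun n hn => ?_⟩
  have hn1 : M < n := (le_max_left _ _).trans_lt hn
  have hn2 : K < n := ((le_max_left _ _).trans (le_max_right _ _)).trans_lt hn
  have hn3 : 2 < n := ((le_max_right _ _).trans (le_max_right _ _)).trans_lt hn
  have hlog : 0 < Real.log n := Real.log_pos (by exact_mod_cast (by omega : 1 < n))
  have h1 := abs_lt.1 (Real.dist_eq _ _ ▸ hM n hn1)
  set D := multiples A \ multiples (trunc A K)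
  have h2 : logAverage (multiples A) n =
      logAverage (multiples (trunc A K)) n + reciprocalSum D n / Real.log n := by
    rw [logAverage_eq, logAverage_eq, ← add_div, reciprocalSum_diff (multiples_mono (trunc_subset A K))]
  have h3 : 0 ≤ reciprocalSum D n / Real.log n := div_nonneg (reciprocalSum_nonneg _ _) hlog.le
  have h4 : reciprocalSum D n / Real.log n ≤ c⁻¹ * η := by
    have e1 := mul_reciprocalSum_diff_le A hn2.le
    rw [haarZ_mult_primesUpTo_compl] at e1
    have e2 := hmertens n hn3.le
    have e3 : c * reciprocalSum D n ≤ Real.log n * η := by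
      calc c * reciprocalSum D n
          ≤ (Real.log n * ∏ p ∈ (n + 1).primesBelow, (1 - (p : ℝ)⁻¹)) * reciprocalSum D n :=
            mul_le_mul_of_nonneg_right e2 (reciprocalSum_nonneg _ _)
        _ = Real.log n * ((∏ p ∈ (n + 1).primesBelow, (1 - (p : ℝ)⁻¹)) * reciprocalSum D n) := by
            ring
        _ ≤ Real.log n * η := mul_le_mul_of_nonneg_left (by linarith) hlog.le
    rw [div_le_iff₀ hlog, inv_mul_eq_div, div_mul_eq_mul_div, le_div_iff₀ hc]
    linarith
  have h5 : η * (2 + c⁻¹) = ε := by rw [hη]; field_simp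
  rw [Real.dist_eq, abs_lt, h2]
  have h6 : 0 < c⁻¹ * η := by positivity
  constructor <;> linarith

lemma logDensity_multiples (A : Set ℕ+) : logDensity (multiples A) = haarZ.real (mult A) :=
  (tendsto_logAverage_multiples A).limUnder_eq

/-- The lower density of a set of multiples is at most its logarithmic density. -/
lemma frequently_count_lt (A : Set ℕ+) {ε : ℝ} (hε : 0 < ε) :
    ∃ᶠ n : ℕ in atTop, (count (multiples A) n : ℝ) < (haarZ.real (mult A) + ε) * n := by
  intro hcon
  simp only [not_lt] at hcon
  obtain ⟨n₀, hn₀⟩ := eventually_atTop.1 hcon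
  set α := haarZ.real (mult A) + ε with hα
  have hα0 : 0 ≤ α := add_nonneg measureReal_nonneg hε.le
  have h : ∀ n : ℕ, α * n - α * n₀ ≤ count (multiples A) n := by
    intro n
    rcases le_total n₀ n with hn | hn
    · have := hn₀ n hn
      have : 0 ≤ α * n₀ := by positivity
      linarith
    · have h1 : (n : ℝ) ≤ n₀ := by exact_mod_cast hn
      have h2 := mul_le_mul_of_nonneg_left h1 hα0
      have : (0 : ℝ) ≤ count (multiples A) n := by positivity
      linarith
  have hle : α ≤ haarZ.real (mult A) := by
    refine le_of_tendsto_of_tendsto' (tendsto_harmonic_div_log α (-(α * n₀)))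
      (tendsto_logAverage_multiples A) fun n => ?_
    exact div_le_div_of_nonneg_right (le_reciprocalSum h n) (Real.log_natCast_nonneg n)
  linarith

/-! ### Patterns of free integers -/

/-- The profinite integers `x` such that, for `i ∈ S`, the shift `x + i` is free of divisors
in `A` exactly at the positions where `w` is `true`. -/
def pattern (A : Set ℕ+) (S : Finset ℤ) (w : ℤ → Bool) : Set Zhat :=
  {x | ∀ i ∈ S, x + toZhat i ∉ mult A ↔ w i = true}

lemma add_Delta_toH_mem_window {B : Set ℕ+} {x : Zhat} {n : ℤ} :
    toH B x + Delta B n ∈ window B ↔ x + toZhat n ∉ mult B := by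
  rw [toH_add_Delta]
  simp [window, mult, toH_apply]

lemma phi_eq_true {B : Set ℕ+} {h : H B} {n : ℤ} :
    phi B h n = true ↔ h + Delta B n ∈ window B := by
  simp [phi, coding]

lemma phi_toH_mem_cylinder {B : Set ℕ+} {S : Finset ℤ} {w : ℤ → Bool} {x : Zhat} :
    phi B (toH B x) ∈ cylinder S w ↔ x ∈ pattern B S w := by
  refine forall_congr' fun i => forall_congr' fun _ => ?_
  rw [Bool.eq_iff_iff, phi_eq_true, add_Delta_toH_mem_window]

lemma eta_eq_true {B : Set ℕ+} {n : ℤ} : eta B n = true ↔ n ∉ multiples B :=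
  @decide_eq_true_iff _ (Classical.propDecidable _)

lemma shift_eta (B : Set ℕ+) (k : ℤ) : shift k (eta B) = phi B (Delta B k) := by
  funext n
  have h : Delta B k = toH B (toZhat k) := rfl
  rw [Bool.eq_iff_iff, phi_eq_true, h, add_Delta_toH_mem_window, ← map_add, toZhat_mem_mult]
  rw [shift, eta_eq_true, add_comm]

lemma shift_eta_mem_cylinder {B : Set ℕ+} {S : Finset ℤ} {w : ℤ → Bool} {k : ℤ} :
    shift k (eta B) ∈ cylinder S w ↔ toZhat k ∈ pattern B S w := by
  rw [shift_eta, ← phi_toH_mem_cylinder]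
  rfl

lemma isClosed_window (B : Set ℕ+) : IsClosed (window B) := by
  have : window B = ⋂ b : B, {h : H B | (h : ProdZMod B) b ≠ 0} := by
    ext; simp [window]
  rw [this]
  exact isClosed_iInter fun b => ((isClopen_discrete {0}ᶜ).preimage (continuous_coord B b)).isClosed

lemma measurable_phi (B : Set ℕ+) : Measurable (phi B) := by
  refine measurable_pi_iff.2 fun n => measurable_to_bool ?_
  have : (fun h => phi B h n) ⁻¹' {true} = (fun h => h + Delta B n) ⁻¹' window B := by
    ext h
    simp only [Set.mem_preimage, Set.mem_singleton_iff, phi_eq_true]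
  rw [this]
  exact (isClosed_window B).measurableSet.preimage (continuous_id.add continuous_const).measurable

lemma isOpen_cylinder (S : Finset ℤ) (w : ℤ → Bool) : IsOpen (cylinder S w) :=
  isOpen_set_pi (s := fun i => {w i}) S.finite_toSet fun _ _ => isOpen_discrete _

lemma mem_cylinder_self (S : Finset ℤ) (w : ℤ → Bool) : w ∈ cylinder S w := fun _ _ => rfl

lemma exists_cylinder_subset {U : Set (ℤ → Bool)} {x : ℤ → Bool} (hU : U ∈ 𝓝 x) :
    ∃ S : Finset ℤ, cylinder S x ⊆ U := by
  obtain ⟨V, hVU, hV, hx⟩ := mem_nhds_iff.1 hU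
  obtain ⟨S, u, hu, hsub⟩ := isOpen_pi_iff.1 hV x hx
  refine ⟨S, fun y hy => hVU (hsub fun i hi => ?_)⟩
  rw [hy i hi]
  exact (hu i hi).2

lemma mirsky_cylinder (B : Set ℕ+) (S : Finset ℤ) (w : ℤ → Bool) :
    mirsky B (cylinder S w) = haarZ (pattern B S w) := by
  have hm := (isOpen_cylinder S w).measurableSet
  rw [mirsky, Measure.map_apply (measurable_phi B) hm, ← map_toH,
    Measure.map_apply (continuous_toH B).measurable (measurable_phi B hm)]
  congr 1
  ext x
  exact phi_toH_mem_cylinder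

lemma mem_pattern_iff_of_agree {A A' : Set ℕ+} {S : Finset ℤ} (w : ℤ → Bool) {x : Zhat}
    (hAA' : A' ⊆ A) (h : ∀ i ∈ S, x + toZhat i ∉ mult A \ mult A') :
    x ∈ pattern A S w ↔ x ∈ pattern A' S w := by
  refine forall_congr' fun i => forall_congr' fun hi => ?_
  have h1 := h i hi
  have h2 : x + toZhat i ∈ mult A' → x + toZhat i ∈ mult A := fun h => mult_mono hAA' h
  rw [Set.mem_sdiff] at h1
  have : x + toZhat i ∈ mult A ↔ x + toZhat i ∈ mult A' := by tauto
  rw [this]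

lemma haarZ_preimage_add_toZhat (k : ℤ) (E : Set Zhat) :
    haarZ {x | x + toZhat k ∈ E} = haarZ E := by
  rw [← haarZ_preimage_toZhat_add k E]
  simp only [add_comm]

/-- Replacing the set of divisors by a subset changes pattern probabilities by at most the
difference of the measures of the sets of multiples, per position. -/
lemma abs_haarZ_pattern_sub_le {A A' : Set ℕ+} (h : A' ⊆ A) (S : Finset ℤ) (w : ℤ → Bool) :
    |haarZ.real (pattern A' S w) - haarZ.real (pattern A S w)| ≤
      S.card * (haarZ.real (mult A) - haarZ.real (mult A')) := by
  set E : Set Zhat := ⋃ i ∈ S, {x | x + toZhat i ∈ mult A \ mult A'} with hE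
  have hEle : haarZ.real E ≤ S.card * (haarZ.real (mult A) - haarZ.real (mult A')) := by
    refine (measureReal_biUnion_finset_le _ _).trans ?_
    rw [← nsmul_eq_mul]
    refine Finset.sum_le_card_nsmul _ _ _ fun i _ => ?_
    rw [measureReal_def, haarZ_preimage_add_toZhat, ← measureReal_def,
      measureReal_sdiff (mult_mono h) (measurableSet_mult _)]
  have hout : ∀ x ∉ E, (x ∈ pattern A S w ↔ x ∈ pattern A' S w) := by
    intro x hx
    refine mem_pattern_iff_of_agree w h fun i hi hxi => hx ?_
    simp only [hE, Set.mem_iUnion]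
    exact ⟨i, hi, hxi⟩
  have h1 : haarZ.real (pattern A S w) ≤ haarZ.real (pattern A' S w) + haarZ.real E := by
    refine (measureReal_mono ?_).trans (measureReal_union_le _ _)
    intro x hx
    by_cases hxE : x ∈ E
    · exact Or.inr hxE
    · exact Or.inl ((hout x hxE).1 hx)
  have h2 : haarZ.real (pattern A' S w) ≤ haarZ.real (pattern A S w) + haarZ.real E := by
    refine (measureReal_mono ?_).trans (measureReal_union_le _ _)
    intro x hx
    by_cases hxE : x ∈ E
    · exact Or.inr hxE
    · exact Or.inl ((hout x hxE).2 hx)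
  rw [abs_le]
  constructor <;> linarith

lemma count_eq_card_int (A : Set ℤ) (n : ℕ) [DecidablePred (· ∈ A)] :
    count A n = ((Finset.Icc (1 : ℤ) n).filter (· ∈ A)).card := by
  classical
  rw [count]
  refine Finset.card_bij (fun k _ => (k : ℤ)) ?_ ?_ ?_
  · intro k hk
    simp only [Finset.mem_filter, Finset.mem_Icc] at hk ⊢
    exact ⟨by omega, hk.2⟩
  · intro k _ l _ h
    exact_mod_cast h
  · intro k hk
    simp only [Finset.mem_filter, Finset.mem_Icc] at hk
    refine ⟨k.toNat, ?_, by omega⟩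
    have : ((k.toNat : ℕ) : ℤ) = k := by omega
    simp only [Finset.mem_filter, Finset.mem_Icc, this]
    exact ⟨by omega, hk.2⟩

lemma count_shift_le (A : Set ℤ) (i : ℤ) (n : ℕ) :
    count {k | k + i ∈ A} n ≤ count A n + i.natAbs := by
  classical
  rw [count_eq_card_int, count_eq_card_int]
  have h1 : ((Finset.Icc (1 : ℤ) n).filter (· ∈ {k | k + i ∈ A})).card
      = ((Finset.Icc (1 + i) (n + i)).filter (· ∈ A)).card := by
    refine Finset.card_bij (fun k _ => k + i) ?_ ?_ ?_
    · intro k hk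
      simp only [Finset.mem_filter, Finset.mem_Icc, Set.mem_ofPred_eq] at hk ⊢
      exact ⟨by omega, hk.2⟩
    · intro k _ l _ h
      omega
    · intro k hk
      simp only [Finset.mem_filter, Finset.mem_Icc] at hk
      refine ⟨k - i, ?_, by omega⟩
      simp only [Finset.mem_filter, Finset.mem_Icc, Set.mem_ofPred_eq, sub_add_cancel]
      exact ⟨by omega, hk.2⟩
  rw [h1]
  have h2 : (Finset.Icc (1 + i) (n + i)).filter (· ∈ A) ⊆
      (Finset.Icc (1 : ℤ) n).filter (· ∈ A) ∪
        (Finset.Icc (1 + i) 0 ∪ Finset.Icc ((n : ℤ) + 1) (n + i)) := by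
    intro k hk
    simp only [Finset.mem_filter, Finset.mem_Icc, Finset.mem_union] at hk ⊢
    by_cases h3 : 1 ≤ k ∧ k ≤ n
    · exact Or.inl ⟨h3, hk.2⟩
    · right; omega
  refine (Finset.card_le_card h2).trans ((Finset.card_union_le _ _).trans ?_)
  refine Nat.add_le_add_left ((Finset.card_union_le _ _).trans ?_) _
  rw [Int.card_Icc, Int.card_Icc]
  omega

lemma count_sdiff {A A' : Set ℤ} (h : A' ⊆ A) (n : ℕ) :
    count A n = count A' n + count (A \ A') n := by
  classical
  simp only [count, Finset.card_filter]
  rw [← Finset.sum_add_distrib]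
  refine Finset.sum_congr rfl fun k _ => ?_
  by_cases h1 : (k : ℤ) ∈ A' <;> by_cases h2 : (k : ℤ) ∈ A <;> simp [h1, h2]
  exact absurd (h h1) h2

lemma count_le_add {A A' E : Set ℤ} (h : A ⊆ A' ∪ E) (n : ℕ) :
    count A n ≤ count A' n + count E n := by
  classical
  unfold count
  refine le_trans (Finset.card_le_card ?_) (Finset.card_union_le _ _)
  intro k hk
  rw [Finset.mem_filter] at hk
  rw [Finset.mem_union, Finset.mem_filter, Finset.mem_filter]
  rcases h hk.2 with h' | h'
  · exact Or.inl ⟨hk.1, h'⟩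
  · exact Or.inr ⟨hk.1, h'⟩

lemma count_biUnion_le (S : Finset ℤ) (A : ℤ → Set ℤ) (n : ℕ) :
    count (⋃ i ∈ S, A i) n ≤ ∑ i ∈ S, count (A i) n := by
  classical
  induction S using Finset.induction_on with
  | empty => simp [count]
  | insert a S ha ih =>
    rw [Finset.sum_insert ha, Finset.set_biUnion_insert]
    exact (count_le_add le_rfl n).trans (Nat.add_le_add_left ih _)

/-- The counting analogue of `abs_haarZ_pattern_sub_le`, with an error from the boundary. -/
lemma abs_count_pattern_sub_le {A A' : Set ℕ+} (h : A' ⊆ A) (S : Finset ℤ) (w : ℤ → Bool) (n : ℕ) :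
    |(count (toZhat ⁻¹' pattern A S w) n : ℝ) - count (toZhat ⁻¹' pattern A' S w) n| ≤
      S.card * ((count (multiples A) n : ℝ) - count (multiples A') n)
        + ∑ i ∈ S, (i.natAbs : ℝ) := by
  set D := multiples A \ multiples A' with hD
  set E : Set ℤ := ⋃ i ∈ S, {k | k + i ∈ D} with hE
  have hcD : (count (multiples A) n : ℝ) - count (multiples A') n = count D n := by
    rw [count_sdiff (multiples_mono h) n]; push_cast; ring
  have hEle : (count E n : ℝ) ≤ S.card * (count D n : ℝ) + ∑ i ∈ S, (i.natAbs : ℝ) := by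
    have h1 : count E n ≤ ∑ i ∈ S, (count D n + i.natAbs) :=
      (count_biUnion_le S _ n).trans (Finset.sum_le_sum fun i _ => count_shift_le D i n)
    rw [Finset.sum_add_distrib, Finset.sum_const, smul_eq_mul] at h1
    exact_mod_cast h1
  have hout : ∀ k ∉ E, (toZhat k ∈ pattern A S w ↔ toZhat k ∈ pattern A' S w) := by
    intro k hk
    refine mem_pattern_iff_of_agree w h fun i hi hki => hk ?_
    simp only [hE, Set.mem_iUnion]
    refine ⟨i, hi, ?_⟩
    rw [← map_add, Set.mem_sdiff, toZhat_mem_mult, toZhat_mem_mult] at hki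
    exact hki
  have h1 : count (toZhat ⁻¹' pattern A S w) n ≤ count (toZhat ⁻¹' pattern A' S w) n + count E n := by
    refine count_le_add (fun k hk => ?_) n
    by_cases hkE : k ∈ E
    · exact Or.inr hkE
    · exact Or.inl ((hout k hkE).1 hk)
  have h2 : count (toZhat ⁻¹' pattern A' S w) n ≤ count (toZhat ⁻¹' pattern A S w) n + count E n := by
    refine count_le_add (fun k hk => ?_) n
    by_cases hkE : k ∈ E
    · exact Or.inr hkE
    · exact Or.inl ((hout k hkE).2 hk)
  have h1' : (count (toZhat ⁻¹' pattern A S w) n : ℝ) ≤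
      count (toZhat ⁻¹' pattern A' S w) n + count E n := by exact_mod_cast h1
  have h2' : (count (toZhat ⁻¹' pattern A' S w) n : ℝ) ≤
      count (toZhat ⁻¹' pattern A S w) n + count E n := by exact_mod_cast h2
  rw [hcD, abs_le]
  constructor <;> linarith

lemma isClopen_pattern {A : Set ℕ+} (hA : A.Finite) (S : Finset ℤ) (w : ℤ → Bool) :
    IsClopen (pattern A S w) := by
  have : pattern A S w = ⋂ i ∈ S, {x | x + toZhat i ∉ mult A ↔ w i = true} := by
    ext; simp [pattern]
  rw [this]
  refine isClopen_biInter_finset fun i _ => ?_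
  have hc : IsClopen ((fun x : Zhat => x + toZhat i) ⁻¹' mult A) :=
    (isClopen_mult hA).preimage (continuous_id.add continuous_const)
  cases hw : w i
  · convert hc using 1
    ext x; simp
  · convert hc.compl using 1
    ext x; simp

lemma abs_count_pattern_trunc_sub_le (A : Set ℕ+) (K : ℕ) (S : Finset ℤ) (w : ℤ → Bool) (n : ℕ) :
    |(count (toZhat ⁻¹' pattern (trunc A K) S w) n : ℝ)
      - n * haarZ.real (pattern (trunc A K) S w)| ≤ K.factorial := by
  refine abs_count_sub_le (isClopen_pattern (finite_trunc A K) S w) K.factorial_ne_zero (fun x => ?_) n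
  refine forall_congr' fun i => forall_congr' fun _ => ?_
  have : x + toZhat (K.factorial : ℕ) + toZhat i ∈ mult (trunc A K) ↔
      x + toZhat i ∈ mult (trunc A K) := by
    refine exists_congr fun a => and_congr_right fun ha => ?_
    rw [add_right_comm, red_add_toZhat_factorial ha]
  rw [this]

/-- Along times at which the set of multiples has nearly its least possible frequency, the
sequence `eta B` is well approximated by the periodic sequences of the truncations of `B`. -/
theorem isQuasiGeneric_eta (B : Set ℕ+) : IsQuasiGeneric (eta B) (mirsky B) := by
  set δ := haarZ.real (mult B) with hδ
  obtain ⟨N, hN, hNlt⟩ := extraction_forall_of_frequently fun j : ℕ =>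
    frequently_count_lt B (ε := 1 / ((j : ℝ) + 1)) (by positivity)
  refine ⟨N, hN, fun S w => ?_⟩
  suffices key : Tendsto (fun j => (count (toZhat ⁻¹' pattern B S w) (N j) : ℝ) / N j) atTop
      (𝓝 ((mirsky B).real (cylinder S w))) by
    refine key.congr fun j => ?_
    rw [count]
    congr 3
    ext k
    simp only [Finset.mem_filter, shift_eta_mem_cylinder, Set.mem_preimage]
  have hNtop : Tendsto (fun j => (N j : ℝ)) atTop atTop :=
    tendsto_natCast_atTop_atTop.comp hN.tendsto_atTop
  rw [measureReal_def, mirsky_cylinder, ← measureReal_def, Metric.tendsto_atTop']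
  intro ε hε
  have hη0 : 0 < ε / (2 * S.card + 1) := by positivity
  obtain ⟨K, hK⟩ := ((tendsto_haarZ_mult_trunc B).eventually
    (lt_mem_nhds (sub_lt_self δ hη0))).exists
  set δK := haarZ.real (mult (trunc B K)) with hδK
  have hδle : δK ≤ δ := measureReal_mono (mult_mono (trunc_subset B K))
  -- The total error at time `N j` when `B` is replaced by its elements up to `K`.
  set bound : ℕ → ℝ := fun j => S.card * (δ + 1 / ((j : ℝ) + 1) - δK + K.factorial / N j)
    + (∑ i ∈ S, (i.natAbs : ℝ)) / N j + K.factorial / N j + S.card * (δ - δK) with hbound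
  have hlim : Tendsto bound atTop (𝓝 (S.card * (δ + 0 - δK + 0) + 0 + 0 + S.card * (δ - δK))) := by
    have h1 : ∀ c : ℝ, Tendsto (fun j => c / (N j : ℝ)) atTop (𝓝 0) := fun c =>
      tendsto_const_nhds.div_atTop hNtop
    exact (((((tendsto_one_div_add_atTop_nhds_zero_nat.const_add δ).sub_const δK).add
      (h1 _)).const_mul _).add (h1 _)).add (h1 _) |>.add_const _
  have hsmall : S.card * (δ + 0 - δK + 0) + 0 + 0 + S.card * (δ - δK) < ε := by
    have h1 : δ - δK ≤ ε / (2 * S.card + 1) := by linarith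
    have h2 : 2 * (S.card : ℝ) * (δ - δK) ≤ 2 * S.card * (ε / (2 * S.card + 1)) := by gcongr
    have h3 : (2 * (S.card : ℝ) + 1) * (ε / (2 * S.card + 1)) = ε := by field_simp
    linarith
  obtain ⟨J, hJ⟩ := eventually_atTop.1 ((hlim.eventually (gt_mem_nhds hsmall)).and
    (hNtop.eventually_gt_atTop 0))
  refine ⟨J, fun j hj => ?_⟩
  obtain ⟨hj1, hj2⟩ := hJ j hj.le
  refine lt_of_le_of_lt ?_ hj1
  rw [Real.dist_eq]
  have e1 := abs_count_pattern_sub_le (trunc_subset B K) S w (N j)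
  have e2 := abs_count_pattern_trunc_sub_le B K S w (N j)
  have e3 := abs_haarZ_pattern_sub_le (trunc_subset B K) S w
  have e4 := (hNlt j).le
  have e5 := (abs_le.1 (abs_count_multiples_trunc_sub_le B K (N j))).1
  have e6 : S.card * ((count (multiples B) (N j) : ℝ) - count (multiples (trunc B K)) (N j)) ≤
      S.card * ((δ + 1 / ((j : ℝ) + 1)) * N j - (N j * δK - K.factorial)) := by
    gcongr
    linarith
  set cB : ℝ := ((count (toZhat ⁻¹' pattern B S w) (N j) : ℕ) : ℝ)
  set cK : ℝ := ((count (toZhat ⁻¹' pattern (trunc B K) S w) (N j) : ℕ) : ℝ)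
  set pB := haarZ.real (pattern B S w)
  set pK := haarZ.real (pattern (trunc B K) S w)
  have e7 : |cB - N j * pB| ≤ N j * bound j := by
    have h1 : |cB - N j * pB| ≤ |cB - cK| + |cK - N j * pK| + N j * |pK - pB| := by
      have h0 : (N j : ℝ) * |pK - pB| = |N j * (pK - pB)| := by rw [abs_mul, abs_of_pos hj2]
      have h1 : cB - N j * pB = (cB - cK) + (cK - N j * pK) + N j * (pK - pB) := by ring
      rw [h0, h1]
      exact abs_add_three _ _ _
    have h2 : (N j : ℝ) * |pK - pB| ≤ N j * (S.card * (δ - δK)) := by gcongr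
    have h3 : N j * bound j = S.card * ((δ + 1 / ((j : ℝ) + 1)) * N j - (N j * δK - K.factorial))
        + ∑ i ∈ S, (i.natAbs : ℝ) + K.factorial + N j * (S.card * (δ - δK)) := by
      simp only [hbound]
      field_simp
      ring
    linarith
  have e8 : cB / N j - pB = (cB - N j * pB) / N j := by field_simp
  rw [e8, abs_div, abs_of_pos hj2, div_le_iff₀ hj2, mul_comm (bound j)]
  exact e7

/-! ### Consequences of tautness -/

/-- Removing an element other than `1` does not destroy the property that almost every profinite
integer is a multiple of an element of `A`. -/
lemma haarZ_mult_sdiff_singleton {A : Set ℕ+} (hA : haarZ.real (mult A) = 1) {a₀ : ℕ+}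
    (ha₀ : a₀ ≠ 1) : haarZ.real (mult (A \ {a₀})) = 1 := by
  by_contra hne
  have hlt : haarZ.real (mult (A \ {a₀})) < 1 := lt_of_le_of_ne measureReal_le_one hne
  obtain ⟨K, hK, hKa⟩ := (((tendsto_haarZ_mult_rough hlt).eventually
    (gt_mem_nhds one_pos)).and (eventually_ge_atTop (a₀ : ℕ))).exists
  have hind := haarZ_inter_mult_compl (N := pfact K) (C := rough (A \ {a₀}) K)
    (fun a ha => factorial_coprime_of_rough ha) {1}
  have hsub : red (pfact K) ⁻¹' {1} ∩ (mult (rough (A \ {a₀}) K))ᶜ ⊆ (mult A)ᶜ := by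
    rintro x ⟨hx1, hx2⟩ ⟨a, ha, hxa⟩
    have hbig : ∀ p : ℕ, p.Prime → p ∣ (a : ℕ) → K < p := by
      intro p hp hpa
      by_contra! hpK
      have h1 : red ⟨p, hp.pos⟩ x = ((1 : ℤ) : ZMod p) :=
        red_eq_of_dvd (d := ⟨p, hp.pos⟩) (n := pfact K)
          (PNat.dvd_iff.2 (Nat.dvd_factorial hp.pos hpK)) (by simpa using hx1)
      have h2 : red ⟨p, hp.pos⟩ x = 0 := red_eq_zero_of_dvd (PNat.dvd_iff.2 hpa) hxa
      rw [h2, Int.cast_one] at h1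
      have : Fact (1 < p) := ⟨hp.one_lt⟩
      exact zero_ne_one (α := ZMod p) h1
    by_cases haa : a = a₀
    · have h1 : (a : ℕ) ≠ 1 := fun h => ha₀ (haa ▸ PNat.eq h)
      obtain ⟨p, hp, hpa⟩ := Nat.exists_prime_and_dvd h1
      have h2 := hbig p hp hpa
      have h3 := Nat.le_of_dvd a.pos hpa
      rw [haa] at h3
      omega
    · exact hx2 ⟨a, ⟨⟨ha, haa⟩, hbig⟩, hxa⟩
  have h0 : haarZ.real (mult A)ᶜ = 0 := by
    rw [probReal_compl_eq_one_sub (measurableSet_mult A), hA, sub_self]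
  have hle := measureReal_mono (μ := haarZ) hsub
  rw [hind, h0, probReal_compl_eq_one_sub (measurableSet_mult _)] at hle
  have hpos : 0 < haarZ.real (red (pfact K) ⁻¹' {1}) := by
    have := haarZ_residue (pfact K) 1
    rw [Int.cast_one] at this
    rw [measureReal_def, show red (pfact K) ⁻¹' {1} = {x | red (pfact K) x = 1} from rfl, this]
    simp [(pfact K).pos]
  have : 0 < haarZ.real (red (pfact K) ⁻¹' {1}) * (1 - haarZ.real (mult (rough (A \ {a₀}) K))) :=
    mul_pos hpos (by linarith)
  linarith

/-- A taut set contains no rescaled copy `c * A` of a set `A` (not containing `1`) whose multiples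
have full measure. -/
lemma haarZ_mult_quotient_lt_one {B : Set ℕ+} (hB : IsTaut B) {c : ℕ+} (hc : c ∉ B) :
    haarZ.real (mult {a | c * a ∈ B}) < 1 := by
  by_contra hcon
  have h1 : haarZ.real (mult {a | c * a ∈ B}) = 1 := le_antisymm measureReal_le_one (not_lt.1 hcon)
  obtain ⟨a₀, ha₀⟩ : {a | c * a ∈ B}.Nonempty := by
    rw [Set.nonempty_iff_ne_empty]
    intro h
    simp [h] at h1
  have ha₀1 : a₀ ≠ 1 := by
    rintro rfl
    exact hc (by simpa using ha₀)
  have h2 := haarZ_mult_sdiff_singleton h1 ha₀1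
  set b := c * a₀ with hb
  have hmB := measurableSet_mult (B \ {b})
  have h3 : haarZ {x | toZhat 0 + (c : ℕ) • x ∈ mult (B \ {b})} = 1 := by
    refine le_antisymm prob_le_one ?_
    have : haarZ (mult ({a | c * a ∈ B} \ {a₀})) = 1 := by
      rw [measureReal_def] at h2
      rw [← ENNReal.toReal_eq_one_iff]; exact h2
    rw [← this]
    refine measure_mono ?_
    rintro x ⟨a, ⟨ha, hne⟩, hx⟩
    refine ⟨c * a, ⟨ha, fun h => hne (mul_left_cancel (Set.mem_singleton_iff.1 h))⟩, ?_⟩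
    rw [map_zero, zero_add]
    exact red_mul_nsmul_eq_zero.2 hx
  have h4 := haarZ_inter_residue c 0 hmB
  rw [h3, one_div, ← haarZ_residue c 0] at h4
  have h5 : haarZ.real ({x | red c x = ((0 : ℤ) : ZMod c)} \ mult (B \ {b})) = 0 := by
    have := measureReal_inter_add_sdiff (μ := haarZ) (s := {x | red c x = ((0 : ℤ) : ZMod c)}) hmB
    rw [measureReal_def, h4, ← measureReal_def] at this
    linarith
  have h6 : haarZ.real (mult B) ≤ haarZ.real (mult (B \ {b})) := by
    have : mult B ⊆ mult (B \ {b}) ∪ ({x | red c x = ((0 : ℤ) : ZMod c)} \ mult (B \ {b})) := by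
      rintro x ⟨b', hb', hx⟩
      by_cases hbb : b' = b
      · by_cases hxB : x ∈ mult (B \ {b})
        · exact Or.inl hxB
        · refine Or.inr ⟨?_, hxB⟩
          rw [hbb, hb] at hx
          simpa using red_eq_zero_of_dvd (Dvd.intro a₀ rfl) hx
      · exact Or.inl ⟨b', ⟨hb', hbb⟩, hx⟩
    have := (measureReal_mono (μ := haarZ) this).trans (measureReal_union_le _ _)
    linarith
  have h7 := hB b ha₀
  rw [logDensity_multiples, logDensity_multiples] at h7
  linarith

/-! ### Positivity of patterns for taut sets -/

/-- Finitely many linear forms `α n + β n * t` with coprime coefficients can be made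
simultaneously prime to all primes up to `K`, provided that modulo each prime `p` fewer than `p`
of them depend on `t`. -/
lemma exists_forall_not_dvd (S : Finset ℤ) (α β : ℤ → ℤ) (hαβ : ∀ n ∈ S, IsCoprime (α n) (β n))
    (K : ℕ) (hcard : ∀ p : ℕ, p.Prime → (S.filter fun n => ¬ (p : ℤ) ∣ β n).card < p) :
    ∃ t : ℤ, ∀ p : ℕ, p.Prime → p ≤ K → ∀ n ∈ S, ¬ (p : ℤ) ∣ α n + β n * t := by
  classical
  have hloc : ∀ p : ℕ, ∃ t : ℕ, p.Prime → ∀ n ∈ S, ¬ (p : ℤ) ∣ α n + β n * t := by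
    intro p
    by_cases hp : p.Prime
    swap
    · exact ⟨0, fun h => absurd h hp⟩
    have : Fact p.Prime := ⟨hp⟩
    set bad : Finset (ZMod p) :=
      (S.filter fun n => ¬ (p : ℤ) ∣ β n).image fun n => -(α n : ZMod p) / (β n : ZMod p)
    have hbad : bad.card < (Finset.univ : Finset (ZMod p)).card := by
      rw [Finset.card_univ, ZMod.card]
      exact Finset.card_image_le.trans_lt (hcard p hp)
    obtain ⟨t, -, ht⟩ := Finset.exists_mem_notMem_of_card_lt_card hbad
    refine ⟨t.val, fun _ n hn hdvd => ?_⟩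
    have h0 : (α n : ZMod p) + β n * t = 0 := by
      have := (ZMod.intCast_zmod_eq_zero_iff_dvd _ _).2 hdvd
      simpa using this
    by_cases hβ : (p : ℤ) ∣ β n
    · have hα : (p : ℤ) ∣ α n := (Int.dvd_add_left (hβ.mul_right _)).1 hdvd
      have h1 := (hαβ n hn).isUnit_of_dvd' hα hβ
      exact (Nat.prime_iff_prime_int.1 hp).not_isUnit h1
    · refine ht (Finset.mem_image.2 ⟨n, Finset.mem_filter.2 ⟨hn, hβ⟩, ?_⟩)
      have hβ' : (β n : ZMod p) ≠ 0 := fun h =>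
        hβ ((ZMod.intCast_zmod_eq_zero_iff_dvd _ _).1 h)
      rw [div_eq_iff hβ']
      linear_combination -h0
  choose τ hτ using hloc
  obtain ⟨k, hk⟩ := Nat.chineseRemainderOfFinset τ id ((Finset.range (K + 1)).filter Nat.Prime)
    (fun p hp => (Finset.mem_filter.1 hp).2.ne_zero) (fun p hp q hq hpq =>
      (Nat.coprime_primes (Finset.mem_filter.1 hp).2 (Finset.mem_filter.1 hq).2).2 hpq)
  refine ⟨k, fun p hp hpK n hn hdvd => hτ p hp n hn ?_⟩
  have h1 : k ≡ τ p [MOD p] := hk p (Finset.mem_filter.2 ⟨Finset.mem_range.2 (by omega), hp⟩)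
  have h2 : (p : ℤ) ∣ (τ p : ℤ) - k := (Nat.modEq_iff_dvd.1 h1)
  have h3 : α n + β n * τ p = (α n + β n * k) + β n * ((τ p : ℤ) - k) := by ring
  rw [h3]
  exact dvd_add hdvd (h2.mul_left _)

/-- If a modulus `L` is the power of a number divisible by all primes up to the cardinality of
`S`, with an exponent that is large compared with the spread of `S`, then modulo each prime `p`
fewer than `p` of the numbers `L / gcd (r + n, L)` are nonzero: if `p` divides `L`, at most one
of the numbers `r + n` is divisible by the full power of `p` in `L`. -/
lemma card_filter_not_dvd_lt (S : Finset ℤ) (r : ℤ) {L₁ e : ℕ}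
    (hS : ∀ n ∈ S, ∀ n' ∈ S, |n - n'| < 2 ^ e) (hL : ∀ p : ℕ, p.Prime → p ≤ S.card → p ∣ L₁)
    {p : ℕ} (hp : p.Prime) :
    (S.filter fun n => ¬ (p : ℤ) ∣ ((L₁ ^ e / Int.gcd (r + n) (L₁ ^ e : ℕ) : ℕ) : ℤ)).card < p := by
  by_cases hpL : p ∣ L₁
  · refine lt_of_le_of_lt (Finset.card_le_one.2 fun n hn n' hn' => ?_) hp.one_lt
    rw [Finset.mem_filter] at hn hn'
    have hdiv : ∀ n : ℤ, ¬ (p : ℤ) ∣ ((L₁ ^ e / Int.gcd (r + n) (L₁ ^ e : ℕ) : ℕ) : ℤ) →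
        ((p ^ e : ℕ) : ℤ) ∣ r + n := by
      intro n hn
      have h1 : p ^ e ∣ Int.gcd (r + n) (L₁ ^ e : ℕ) * (L₁ ^ e / Int.gcd (r + n) (L₁ ^ e : ℕ)) := by
        rw [Nat.mul_div_cancel' (Int.natCast_dvd_natCast.1 (Int.gcd_dvd_right _ _))]
        exact pow_dvd_pow_of_dvd hpL e
      have h2 : (p ^ e).Coprime (L₁ ^ e / Int.gcd (r + n) (L₁ ^ e : ℕ)) :=
        Nat.Coprime.pow_left _ ((hp.coprime_iff_not_dvd).2 fun h => hn (Int.natCast_dvd_natCast.2 h))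
      exact (Int.natCast_dvd_natCast.2 (h2.dvd_of_dvd_mul_right h1)).trans (Int.gcd_dvd_left _ _)
    have h1 : ((p ^ e : ℕ) : ℤ) ∣ n - n' := by
      have := dvd_sub (hdiv n hn.2) (hdiv n' hn'.2)
      rwa [add_sub_add_left_eq_sub] at this
    have h2 : |n - n'| < ((p ^ e : ℕ) : ℤ) := by
      refine (hS n hn.1 n' hn'.1).trans_le ?_
      exact_mod_cast Nat.pow_le_pow_left hp.two_le e
    have := Int.eq_zero_of_abs_lt_dvd h1 h2
    omega
  · refine lt_of_le_of_lt (Finset.card_filter_le _ _) ?_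
    by_contra! h
    exact hpL (hL p hp h)

/-- In the integers, if `b` divides `D * X` then `b / gcd (b, D)` divides `X`. -/
lemma exists_mul_eq_of_dvd_mul {b : ℕ+} {D : ℕ} {X : ℤ} (h : ((b : ℕ) : ℤ) ∣ D * X) :
    ∃ c a : ℕ+, c * a = b ∧ (c : ℕ) ∣ D ∧ ((a : ℕ) : ℤ) ∣ X := by
  have hc : 0 < Nat.gcd b D := Nat.gcd_pos_of_pos_left _ b.pos
  obtain ⟨a, ha⟩ := Nat.gcd_dvd_left b D
  obtain ⟨d, hd⟩ := Nat.gcd_dvd_right b D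
  have ha0 : 0 < a := Nat.pos_of_ne_zero fun h0 => b.ne_zero (by rw [ha, h0, mul_zero])
  refine ⟨⟨_, hc⟩, ⟨a, ha0⟩, PNat.eq ha.symm, Nat.gcd_dvd_right b D, ?_⟩
  have hcop : Nat.Coprime a d := by
    have := Nat.coprime_div_gcd_div_gcd hc
    rwa [Nat.div_eq_of_eq_mul_right hc ha, Nat.div_eq_of_eq_mul_right hc hd] at this
  have h1 : ((Nat.gcd b D : ℕ) : ℤ) * a ∣ (Nat.gcd b D : ℕ) * (d * X) := by
    rw [← mul_assoc, ← Nat.cast_mul, ← Nat.cast_mul, ← ha, ← hd]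
    exact h
  have h2 : (a : ℤ) ∣ d * X := (mul_dvd_mul_iff_left (by exact_mod_cast hc.ne')).1 h1
  exact (Nat.isCoprime_iff_coprime.2 hcop).dvd_of_dvd_mul_left h2

/-- For a taut set, every finite pattern which occurs in some point of `φ(H)` has positive
probability. -/
lemma haarZ_pattern_phi_pos {B : Set ℕ+} (hB : IsTaut B) (h : H B) (S : Finset ℤ) :
    0 < haarZ.real (pattern B S (phi B h)) := by
  classical
  set S₁ := S.filter fun n => phi B h n = true with hS₁
  -- The divisors responsible for the zeros of the pattern.
  have hzero : ∀ n : ℤ, ∃ b : ℕ+, phi B h n = false →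
      ∃ hb : b ∈ B, (h : ProdZMod B) ⟨b, hb⟩ + n = 0 := by
    intro n
    by_cases hn : phi B h n = false
    · have h1 : ¬ (h + Delta B n ∈ window B) := by
        rw [← phi_eq_true, hn]; simp
      simp only [window, Set.mem_ofPred_eq, not_forall, not_not] at h1
      obtain ⟨b, hb⟩ := h1
      exact ⟨b, fun _ => ⟨b.2, hb⟩⟩
    · exact ⟨1, fun h' => absurd h' hn⟩
  choose β hβ using hzero
  have hone : ∀ n ∈ S₁, ∀ b : B, (h : ProdZMod B) b + n ≠ 0 := by
    intro n hn b
    exact phi_eq_true.1 (Finset.mem_filter.1 hn).2 b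
  -- The modulus `L`.
  set L₁ : ℕ := (∏ n ∈ S, (β n : ℕ)) * S₁.card.factorial with hL₁
  set e : ℕ := 2 * (∑ n ∈ S, n.natAbs) + 1 with he
  have hL₁pos : 0 < L₁ :=
    Nat.mul_pos (Finset.prod_pos fun n _ => (β n).pos) (Nat.factorial_pos _)
  set L : ℕ+ := ⟨L₁ ^ e, pow_pos hL₁pos e⟩ with hL
  have hβL : ∀ n ∈ S, β n ∣ L := by
    intro n hn
    rw [PNat.dvd_iff]
    exact ((Finset.dvd_prod_of_mem (fun n => (β n : ℕ)) hn).mul_right _).trans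
      (dvd_pow_self L₁ (by omega))
  have hspread : ∀ n ∈ S₁, ∀ n' ∈ S₁, |n - n'| < 2 ^ e := by
    intro n hn n' hn'
    have h1 := Finset.single_le_sum (f := Int.natAbs) (fun _ _ => Nat.zero_le _)
      (Finset.mem_filter.1 hn).1
    have h2 := Finset.single_le_sum (f := Int.natAbs) (fun _ _ => Nat.zero_le _)
      (Finset.mem_filter.1 hn').1
    have h3 : |n - n'| < e := by
      have : |n - n'| ≤ |n| + |n'| := abs_sub n n'
      rw [Int.abs_eq_natAbs n, Int.abs_eq_natAbs n'] at this
      have h4 : ((n.natAbs + n'.natAbs : ℕ) : ℤ) < (e : ℕ) := by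
        exact_mod_cast (by omega : n.natAbs + n'.natAbs < e)
      push_cast at h4 ⊢
      omega
    exact h3.trans (by exact_mod_cast Nat.lt_two_pow_self)
  -- An integer that looks like `h` at all coordinates dividing `L`.
  obtain ⟨r, hr⟩ := exists_int_eq h {b : B | (b : ℕ+) ∣ L}
    (((Set.finite_le_nat L).preimage (PNat.coe_injective.comp Subtype.val_injective).injOn).subset
      fun b hb => PNat.le_of_dvd hb)
  set D : ℤ → ℕ := fun n => Int.gcd (r + n) (L : ℕ) with hD
  have hDL : ∀ n, D n ∣ L := fun n => Int.natCast_dvd_natCast.1 (Int.gcd_dvd_right _ _)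
  have hDpos : ∀ n, 0 < D n := fun n => Nat.pos_of_dvd_of_pos (hDL n) L.pos
  have hDB : ∀ n ∈ S₁, ∀ c : ℕ+, (c : ℕ) ∣ D n → c ∉ B := by
    intro n hn c hc hcB
    refine hone n hn ⟨c, hcB⟩ ?_
    rw [hr ⟨c, hcB⟩ (PNat.dvd_iff.2 (hc.trans (hDL n))), ← Int.cast_add,
      ZMod.intCast_zmod_eq_zero_iff_dvd]
    exact (Int.natCast_dvd_natCast.2 hc).trans (Int.gcd_dvd_left _ _)
  -- By tautness, almost nothing is a multiple of a rough quotient `b / c`.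
  set C : Finset ℕ+ := (Finset.Icc 1 L).filter fun c => c ∉ B with hC
  set ε : ℝ := 1 / ((S₁.card + 1) * (C.card + 1)) with hε
  have hε0 : 0 < ε := by positivity
  obtain ⟨K, hKL, hK⟩ : ∃ K : ℕ, (L : ℕ) ≤ K ∧
      ∀ c ∈ C, haarZ.real (mult (rough {a | c * a ∈ B} K)) < ε := by
    refine ((eventually_ge_atTop (L : ℕ)).and ((Filter.eventually_all_finset C).2
      fun c hc => ?_)).exists
    exact (tendsto_haarZ_mult_rough (haarZ_mult_quotient_lt_one hB
      (Finset.mem_filter.1 hc).2)).eventually (gt_mem_nhds hε0)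
  set α : ℤ → ℤ := fun n => (r + n) / D n with hα
  set γ : ℤ → ℕ := fun n => L / D n with hγ
  have hαD : ∀ n, r + n = D n * α n := fun n =>
    (Int.mul_ediv_cancel' (Int.gcd_dvd_left _ _)).symm
  have hγD : ∀ n, (L : ℕ) = D n * γ n := fun n => (Nat.mul_div_cancel' (hDL n)).symm
  have hcop : ∀ n ∈ S₁, IsCoprime (α n) (γ n : ℤ) := by
    intro n _
    rw [Int.isCoprime_iff_gcd_eq_one]
    have := Int.gcd_div_gcd_div_gcd (hDpos n)
    rwa [← Int.natCast_div] at this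
  obtain ⟨t, ht⟩ := exists_forall_not_dvd S₁ α (fun n => (γ n : ℤ)) hcop K fun p hp =>
    card_filter_not_dvd_lt S₁ r hspread (fun q hq hqS =>
      (hq.dvd_factorial.2 hqS).mul_left _) hp
  set M : ℕ+ := L * pfact K with hM
  have hMcoe : (M : ℕ) = L * K.factorial := rfl
  set m : ℤ := r + L * t with hm
  set y : ℤ → ℤ := fun n => α n + γ n * t with hy
  set z : ℤ → ℕ := fun n => γ n * K.factorial with hz
  have hyD : ∀ n, m + n = D n * y n := by
    intro n
    have h1 := hαD n
    have h2 : ((L : ℕ) : ℤ) = D n * γ n := by exact_mod_cast hγD n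
    rw [hm, hy, h2]
    linear_combination h1
  have hzD : ∀ n, (M : ℕ) = D n * z n := by
    intro n
    rw [hMcoe, hγD n, hz, mul_assoc]
  -- The bad part of the residue class of `m` modulo `M`.
  have hbad : {x | toZhat m + (M : ℕ) • x ∈ pattern B S (phi B h)}ᶜ ⊆
      ⋃ n ∈ S₁, ⋃ c ∈ C, {x | toZhat (y n) + z n • x ∈ mult (rough {a | c * a ∈ B} K)} := by
    intro x hx
    simp only [pattern, Set.mem_compl_iff, Set.mem_ofPred_eq, not_forall] at hx
    obtain ⟨n, hnS, hn⟩ := hx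
    by_cases hphi : phi B h n = true
    · have hnS₁ : n ∈ S₁ := Finset.mem_filter.2 ⟨hnS, hphi⟩
      simp only [hphi, iff_true, not_not] at hn
      obtain ⟨b, hb, hbx⟩ := hn
      obtain ⟨u, hu⟩ := exists_int_red_of_dvd x b
      have hbu : ((b : ℕ) : ℤ) ∣ D n * (y n + z n * u) := by
        have h1 : red b (toZhat m + (M : ℕ) • x + toZhat n) = ((m + M * u + n : ℤ) : ZMod b) := by
          rw [map_add, red_affine, hu b dvd_rfl, red_toZhat]
          push_cast
          rfl
        rw [h1, ZMod.intCast_zmod_eq_zero_iff_dvd] at hbx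
        have h2 : m + M * u + n = D n * (y n + z n * u) := by
          have := hzD n
          have h3 : ((M : ℕ) : ℤ) = D n * z n := by exact_mod_cast this
          rw [h3]
          linear_combination hyD n
        rwa [h2] at hbx
      obtain ⟨c, a, hca, hcD, haX⟩ := exists_mul_eq_of_dvd_mul hbu
      have hcC : c ∈ C := by
        refine Finset.mem_filter.2 ⟨Finset.mem_Icc.2 ⟨one_le, ?_⟩, hDB n hnS₁ c hcD⟩
        exact PNat.le_of_dvd (PNat.dvd_iff.2 (hcD.trans (hDL n)))
      simp only [Set.mem_iUnion]
      refine ⟨n, hnS₁, c, hcC, a, ⟨by rw [Set.mem_ofPred_eq, hca]; exact hb, fun p hp hpa => ?_⟩, ?_⟩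
      · by_contra! hpK
        refine ht p hp hpK n hnS₁ ?_
        have h1 : (p : ℤ) ∣ y n + z n * u := (Int.natCast_dvd_natCast.2 hpa).trans haX
        have h2 : (p : ℤ) ∣ z n * u := by
          refine Dvd.dvd.mul_right (Int.natCast_dvd_natCast.2 ?_) _
          exact (hp.dvd_factorial.2 hpK).mul_left _
        exact (Int.dvd_add_left h2).1 h1
      · rw [red_affine, hu a (Dvd.intro_left c hca)]
        have := (ZMod.intCast_zmod_eq_zero_iff_dvd _ _).2 haX
        push_cast at this
        exact this
    · exfalso
      have hfalse : phi B h n = false := by simpa using hphi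
      apply hn
      rw [hfalse]
      simp only [Bool.false_eq_true, iff_false, not_not]
      obtain ⟨hb, hbn⟩ := hβ n hfalse
      refine ⟨β n, hb, ?_⟩
      have hβM : ((M : ℕ) : ZMod (β n)) = 0 := by
        rw [ZMod.natCast_eq_zero_iff, hMcoe]
        exact (PNat.dvd_iff.1 (hβL n hnS)).mul_right _
      have hβL' : ((L : ℕ) : ZMod (β n)) = 0 := by
        rw [ZMod.natCast_eq_zero_iff]
        exact PNat.dvd_iff.1 (hβL n hnS)
      rw [map_add, red_affine, red_toZhat, hβM, zero_mul, add_zero, hm]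
      push_cast
      rw [hβL', zero_mul, add_zero]
      rw [hr ⟨β n, hb⟩ (hβL n hnS)] at hbn
      exact hbn
  have hmeas : MeasurableSet (pattern B S (phi B h)) := by
    have := measurable_phi B (isOpen_cylinder S (phi B h)).measurableSet
    have := (continuous_toH B).measurable this
    convert this using 1
    ext x
    exact phi_toH_mem_cylinder.symm
  have hbadle : haarZ.real {x | toZhat m + (M : ℕ) • x ∈ pattern B S (phi B h)}ᶜ < 1 := by
    calc haarZ.real {x | toZhat m + (M : ℕ) • x ∈ pattern B S (phi B h)}ᶜ
        ≤ ∑ n ∈ S₁, ∑ c ∈ C, ε := by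
          refine (measureReal_mono hbad (measure_ne_top _ _)).trans ((measureReal_biUnion_finset_le _ _).trans ?_)
          refine Finset.sum_le_sum fun n _ => (measureReal_biUnion_finset_le _ _).trans ?_
          refine Finset.sum_le_sum fun c hc => ?_
          rw [measureReal_def, haarZ_affine_mult, ← measureReal_def]
          · exact (hK c hc).le
          · intro a ha
            refine coprime_of_rough (fun p hp hpz => ?_) ha
            rcases (hp.dvd_mul).1 hpz with h1 | h1
            · refine le_trans (Nat.le_of_dvd L.pos (h1.trans ?_)) hKL
              exact Nat.div_dvd_of_dvd (hDL n)
            · exact hp.dvd_factorial.1 h1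
      _ = (S₁.card * C.card) / ((S₁.card + 1) * (C.card + 1)) := by
          rw [Finset.sum_const, Finset.sum_const, nsmul_eq_mul, nsmul_eq_mul, hε]
          ring
      _ < 1 := by
          rw [div_lt_one (mul_pos (Nat.cast_add_one_pos _) (Nat.cast_add_one_pos _))]
          have h1 : (0 : ℝ) ≤ S₁.card := Nat.cast_nonneg _
          have h2 : (0 : ℝ) ≤ C.card := Nat.cast_nonneg _
          exact mul_lt_mul'' (lt_add_one _) (lt_add_one _) h1 h2
  have hgoodmeas : MeasurableSet {x | toZhat m + (M : ℕ) • x ∈ pattern B S (phi B h)} :=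
    (continuous_affine m M).measurable hmeas
  rw [probReal_compl_eq_one_sub hgoodmeas] at hbadle
  have hres := haarZ_inter_residue M m hmeas
  have hpos : 0 < haarZ.real ({x | red M x = m} ∩ pattern B S (phi B h)) := by
    rw [measureReal_def, hres, ENNReal.toReal_div, ← measureReal_def, ENNReal.toReal_natCast]
    have : (0 : ℝ) < (M : ℕ) := by exact_mod_cast M.pos
    refine div_pos (by linarith) this
  exact hpos.trans_le (measureReal_mono Set.inter_subset_right)

/-! ### The support of the Mirsky measure -/

lemma support_mirsky_subset (B : Set ℕ+) : (mirsky B).support ⊆ Xeta B := by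
  intro x hx
  rw [Xeta, mem_closure_iff_nhds]
  intro U hU
  obtain ⟨S, hS⟩ := exists_cylinder_subset hU
  have hpos : 0 < mirsky B (cylinder S x) := (Measure.mem_support_iff_forall _).1 hx _
    ((isOpen_cylinder S x).mem_nhds (mem_cylinder_self S x))
  have hreal : 0 < (mirsky B).real (cylinder S x) := by
    rw [mirsky_cylinder] at hpos
    rw [measureReal_def, mirsky_cylinder]
    exact ENNReal.toReal_pos hpos.ne' (measure_ne_top _ _)
  obtain ⟨N, -, hN⟩ := isQuasiGeneric_eta B
  obtain ⟨j, hj⟩ := ((hN S x).eventually (lt_mem_nhds hreal)).exists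
  obtain ⟨k, hk⟩ : ∃ k : ℕ, shift (k : ℤ) (eta B) ∈ cylinder S x := by
    by_contra! hno
    simp [hno] at hj
  exact ⟨_, hS hk, k, rfl⟩

lemma Xeta_subset_Xphi (B : Set ℕ+) : Xeta B ⊆ Xphi B := by
  refine closure_mono ?_
  rintro _ ⟨n, rfl⟩
  exact ⟨Delta B n, (shift_eta B n).symm⟩

lemma Xphi_subset_support_mirsky {B : Set ℕ+} (hB : IsTaut B) :
    Xphi B ⊆ (mirsky B).support := by
  refine closure_minimal ?_ Measure.isClosed_support
  rintro _ ⟨h, rfl⟩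
  rw [Measure.mem_support_iff_forall]
  intro U hU
  obtain ⟨S, hS⟩ := exists_cylinder_subset hU
  refine lt_of_lt_of_le ?_ (measure_mono hS)
  rw [mirsky_cylinder]
  exact (ENNReal.toReal_pos_iff.1 (haarZ_pattern_phi_pos hB h S)).1

end BFree

end

theorem theorem4 (B : Set ℕ+) (hprim : BFree.IsPrimitive B) (htaut : BFree.IsTaut B) :
    BFree.IsQuasiGeneric (BFree.eta B) (BFree.mirsky B) ∧
      (BFree.mirsky B).support = BFree.Xeta B ∧ BFree.Xeta B = BFree.Xphi B := by
  have h1 := BFree.support_mirsky_subset B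
  have h2 := BFree.Xeta_subset_Xphi B
  have h3 := BFree.Xphi_subset_support_mirsky htaut
  exact ⟨BFree.isQuasiGeneric_eta B, h1.antisymm (h2.trans h3), h2.antisymm (h3.trans h1)⟩
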